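/- \textbf{Setting.} Let $t=(t^{(i)}_k)_{1\le i\le 3,\,k\ge 1}$, put $\xi(t^{(i)},z)=\sum_{k\ge1}t^{(i)}_kz^k$, and let $t\pm[w]_i$ denote the times in which $t^{(i)}_k$ is replaced by $t^{(i)}_k\pm w^k/k$ for all $k\ge 1$. Let $e_1=(1,0)$, $e_2=(0,1)$, $e=(1,1)$, and let $n_1,n_2,n_3$ be non-negative integers. Let $(\tau_m)_{m\in\mathbb Z^2}$ be a tau function of the $[n_1,n_2,n_3]$-KdV hierarchy, that is, a family of nonzero formal power series $\tau_m(t)\in\mathbb C[[t]]$ such that for all integers $l\ge0$ and all $m,m'\in\mathbb Z^2$ \begin{align*} &\oint_{C_R}\frac{dz}{2\pi i}z^{n_1l+m_1-m_1'}e^{\xi(t^{(1)}-t'^{(1)},z)}\tau_m(t-[z^{-1}]_1)\tau_{m'}(t'+[z^{-1}]_1)\\ =&\oint_{C_r}\frac{dz}{2\pi i}z^{-n_2l+m_2-m_2'}e^{\xi(t^{(2)}-t'^{(2)},z^{-1})}\tau_{m+e}(t-[z]_2)\tau_{m'-e}(t'+[z]_2)\\ &+\oint_{C_r}\frac{dz}{2\pi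 i}(-1)^{m_2+m_2'}z^{-n_3l+m_1-m_2-m_1'+m_2'}e^{\xi(t^{(3)}-t'^{(3)},z^{-1})}\tau_{m+e_1}(t-[z]_3)\tau_{m'-e_1}(t'+[z]_3) \end{align*} in $\mathbb C[[t,t']]$, where each integral (over a large, respectively small, anticlockwise circle) is the coefficient of $z^{-1}$ in the formal expansion of the integrand. \textbf{Operators.} Let $\mathcal B$ be the ring of functions of $m\in\mathbb Z^2$ with values in the fraction field of $\mathbb C[[t]]$. Let $\Lambda_i$ be the shift $m\mapsto m+e_i$, so that $\Lambda_i f(m)=f(m+e_i)\Lambda_i$, and let $\Delta_2=\Lambda_2-1$, $\Delta_2^*=\Lambda_2^{-1}-1$. Let $\mathcal E=\mathcal B[\Lambda_1^{\pm1},\Lambda_2^{\pm1}]$ and, for $\alpha=1,2$, let $\mathcal E_{(\alpha)}^{0,\pm}=\mathcal B((\Lambda_\alpha^{\mp1}))$, and let $\mathcal E_{(\alpha)}^{\pm}\supseteq\mathcal E$ be the ring of finite sums $\sum_j a_j\Lambda_{3-\alpha}^j$ with $j\in\mathbb Z$ and $a_j\in\mathcal E_{(\alpha)}^{0,\pm}$.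 Put $$H=\Lambda_1\Delta_2+\rho,\qquad \rho(m)=\frac{\tau_m\,\tau_{m+e+e_1}}{\tau_{m+e_1}\,\tau_{m+e}}.$$ Define $S_1(\Lambda_1)=\sum_{k\ge0}a^{(1)}_k\Lambda_1^{-k}$, $S_2(\Lambda_2)=\sum_{k\ge0}a^{(2)}_k\Lambda_2^{k}$, $S_3(\Lambda_1)=\sum_{k\ge0}a^{(3)}_k\Lambda_1^{k}$ and $S_3(\Lambda_2^{-1})=\sum_{k\ge0}a^{(3)}_k\Lambda_2^{-k}$ by $$\sum_{k\ge0} a^{(1)}_k(m)z^{-k}=\frac{\tau_m(t-[z^{-1}]_1)}{\tau_m(t)},\quad \sum_{k\ge0} a^{(2)}_k(m)z^{k}=\frac{\tau_{m+e}(t-[z]_2)}{\tau_m(t)},\quad \sum_{k\ge0} a^{(3)}_k(m)z^{k}=(-1)^{m_2}\frac{\tau_{m+e_1}(t-[z]_3)}{\tau_m(t)},$$ and the Lax operators by \begin{align*} L_1&=S_1\Lambda_1S_1^{-1}, & L_3(\Lambda_1)&=S_3(\Lambda_1)\Lambda_1^{-1}S_3(\Lambda_1)^{-1},\\ L_2&=S_2\Lambda_2^{-1}S_2^{-1},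 & L_3(\Lambda_2^{-1})&=S_3(\Lambda_2^{-1})\Lambda_2S_3(\Lambda_2^{-1})^{-1}, \end{align*} with inverses taken in $\mathcal E_{(1)}^{0,+}$, $\mathcal E_{(1)}^{0,-}$, $\mathcal E_{(2)}^{0,-}$, $\mathcal E_{(2)}^{0,+}$ for $S_1$, $S_3(\Lambda_1)$, $S_2$, $S_3(\Lambda_2^{-1})$ respectively. Let \begin{align*} \mathcal L&=(L_1^{n_1})_{1,\ge0}+(L_2^{n_2})_{\Delta_2^*,\ge1}+\big(L_3(\Lambda_1)^{n_3}\big)_{1,<0},\\ \widetilde{\mathcal L}&=(L_1^{n_1})_{1,\ge0}+(L_2^{n_2})_{\Delta_2^*,\ge1}+\big(L_3(\Lambda_2^{-1})^{n_3}\big)_{\Delta_2,\ge1}. \end{align*} Here the index $1,\ge0$ (or $1,<0$) selects the terms of that order in $\Lambda_1$. For $D=\Delta_2$ (or $D=\Delta_2^*$), the index $D,\ge1$ selects the terms of order at least $1$ in $D$ after expanding $\Lambda_2^k=(D+1)^k$ (or $\Lambda_2^{-k}=(D+1)^k$) as $\sum_{j\ge0}\binom kjD^{k-j}$ for all $k\in\mathbb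 Z$. \textbf{Statement.} The direct sum decompositions $\mathcal E_{(\alpha)}^{\pm}=\mathcal E_{(\alpha)}^{0,\pm}\oplus\mathcal E_{(\alpha)}^{\pm}H$ hold for $\alpha=1,2$, and $\mathcal L,\widetilde{\mathcal L}\in\mathcal E$. If $\pi_\alpha^\pm:\mathcal E_{(\alpha)}^{\pm}\to\mathcal E_{(\alpha)}^{0,\pm}$ are the projections of these decompositions, then \begin{align*} \pi_1^+(\mathcal L)&=\pi_1^+(\widetilde{\mathcal L})=L_1^{n_1}, & \pi_1^-(\mathcal L)&=\pi_1^-(\widetilde{\mathcal L})=L_3(\Lambda_1)^{n_3},\\ \pi_2^+(\mathcal L)&=\pi_2^+(\widetilde{\mathcal L})=L_3(\Lambda_2^{-1})^{n_3}, & \pi_2^-(\mathcal L)&=\pi_2^-(\widetilde{\mathcal L})=L_2^{n_2}. \end{align*} -/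

import Mathlib

noncomputable section

namespace ThreeKP

/-! ### Formal difference operators in two shifts -/

/-- The lattice of discrete variables `m = (m₁, m₂)`; `m 0` is `m₁` and `m 1` is `m₂`. -/
abbrev ZLat : Type := Fin 2 → ℤ

/-- The standard basis vector `e₁` of the lattice. -/
def e₁ : ZLat := Pi.single 0 1

/-- The standard basis vector `e₂` of the lattice. -/
def e₂ : ZLat := Pi.single 1 1

/-- The vector `e = e₁ + e₂ = (1, 1)`. -/
def e₁₂ : ZLat := e₁ + e₂

/-- Formal operators `A = ∑_j a_j(m) Λ₁^{j₁} Λ₂^{j₂}`, recorded by their coefficients: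
`A j m` is `a_j(m)`. There is no restriction on the set of `j` that occur. -/
def FOp (K : Type) : Type := ZLat → ZLat → K

namespace FOp

variable {K : Type} [Field K]

instance : AddCommGroup (FOp K) := inferInstanceAs (AddCommGroup (ZLat → ZLat → K))

/-- The operator of multiplication by the function `f`. -/
def scalar (f : ZLat → K) : FOp K := fun j m => if j = 0 then f m else 0

/-- The monomial `Λ₁^{i₁} Λ₂^{i₂}`. -/
def shift (i : ZLat) : FOp K := fun j _ => if j = i then 1 else 0

instance : One (FOp K) := ⟨scalar 1⟩

/-- The product of operators, from `(a(m) Λ^i) (b(m) Λ^k) = a(m) b(m + i) Λ^{i + k}`. In every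
use below the sum has finitely many nonzero terms. -/
instance : Mul (FOp K) := ⟨fun A B j m => ∑ᶠ i : ZLat, A i m * B (j - i) (m + i)⟩

/-- Powers of an operator. -/
def pow (A : FOp K) : ℕ → FOp K
  | 0 => 1
  | n + 1 => pow A n * A

instance : Pow (FOp K) ℕ := ⟨pow⟩

end FOp

open FOp

section Spaces

variable (K : Type) [Field K]

/-- `𝓔 = 𝓑[Λ₁, Λ₁⁻¹, Λ₂, Λ₂⁻¹]`, the operators with finitely many terms. -/
def opE : Set (FOp K) := {A | {j | A j ≠ 0}.Finite}

/-- `𝓔_(α)^ε`. For `ε = 1` these are the operators whose order in `Λ_α` is bounded above, for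
`ε = -1` those whose order in `Λ_α` is bounded below; in both cases the exponents of the other
shift operator are bounded on both sides. The index `α = 0` stands for the first shift operator
and `α = 1` for the second. -/
def opEα (α : Fin 2) (ε : ℤˣ) : Set (FOp K) :=
  {A | ∃ N : ℤ, ∀ j : ZLat, (N < ε * j α ∨ ∃ β, β ≠ α ∧ N < |j β|) → A j = 0}

/-- `𝓔_(α)^{0,ε} = 𝓑((Λ_α^{-ε}))`, the operators of `𝓔_(α)^ε` in `Λ_α` alone. -/
def opEα0 (α : Fin 2) (ε : ℤˣ) : Set (FOp K) :=
  {A | A ∈ opEα K α ε ∧ ∀ j : ZLat, (∃ β, β ≠ α ∧ j β ≠ 0) → A j = 0}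

end Spaces

variable {K : Type} [Field K]

/-- The direct sum decomposition `𝓔_(α)^ε = 𝓔_(α)^{0,ε} ⊕ 𝓔_(α)^ε H`. -/
def DirectSumDecomposition (α : Fin 2) (ε : ℤˣ) (H : FOp K) : Prop :=
  (∀ P ∈ opEα0 K α ε, P ∈ opEα K α ε) ∧ (∀ Q ∈ opEα K α ε, Q * H ∈ opEα K α ε) ∧
    ∀ A ∈ opEα K α ε, ∃! P, P ∈ opEα0 K α ε ∧ ∃ Q ∈ opEα K α ε, A = P + Q * H

/-- The projection `π_α^ε` of `𝓔_(α)^ε` onto `𝓔_(α)^{0,ε}` along `𝓔_(α)^ε H`. -/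
def proj (α : Fin 2) (ε : ℤˣ) (H : FOp K) (A : FOp K) : FOp K :=
  Classical.epsilon fun P => P ∈ opEα0 K α ε ∧ ∃ Q ∈ opEα K α ε, A = P + Q * H

open Classical in
/-- The inverse of `S` in `C` (and `0` if there is none). -/
def invIn (C : Set (FOp K)) (S : FOp K) : FOp K :=
  if h : ∃ T ∈ C, S * T = 1 ∧ T * S = 1 then h.choose else 0

/-- The part `A_{1,≥0}` of nonnegative order in `Λ₁`. -/
def nonnegPart₁ (A : FOp K) : FOp K := fun j m => if 0 ≤ j 0 then A j m else 0

/-- The part `A_{1,<0}` of negative order in `Λ₁`. -/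
def negPart₁ (A : FOp K) : FOp K := fun j m => if j 0 < 0 then A j m else 0

/-- Let `A = ∑_k a_k (Λ₂^ε)^k` be an operator in `Λ₂` alone with `k` bounded above, and let
`D = Λ₂^ε - 1`, so that `D` is `Δ₂` for `ε = 1` and `Δ₂^*` for `ε = -1`. Expanding
`(Λ₂^ε)^k = (D + 1)^k = ∑_{l ≥ 0} (k choose l) D^{k-l}` for all integers `k` gives
`A = ∑_i c_i D^i` with `c_i = ∑_{l ≥ 0} (i+l choose l) a_{i+l}`. This is the part
`A_{D,≥1} = ∑_{i ≥ 1} c_i D^i`. -/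
def deltaPosPart (ε : ℤˣ) (A : FOp K) : FOp K :=
  ∑ᶠ i : ℕ,
    scalar (fun m => ∑ᶠ l : ℕ,
      (Nat.choose (i + 1 + l) l : K) * A (Pi.single 1 (ε * ((i + 1 + l : ℕ) : ℤ))) m) *
    (shift (Pi.single 1 (ε : ℤ)) - 1 : FOp K) ^ (i + 1)

/-! ### Tau functions -/

/-- The time variables: `(i, k)` is the index of `t^{(i+1)}_{k+1}`. -/
abbrev Time : Type := Fin 3 × ℕ

/-- Formal power series in the times `t`. -/
abbrev TSeries : Type := MvPowerSeries Time ℂ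

/-- Formal power series in two sets of times: `Sum.inl` marks `t`, `Sum.inr` marks `t'`. -/
abbrev TTSeries : Type := MvPowerSeries (Time ⊕ Time) ℂ

/-- Quotients of formal power series in the times. -/
abbrev TField : Type := FractionRing TSeries

/-- For `f(t)`, the power series in `w` given by `f(t + c [w]_i)`: every `t^{(i)}_k` is replaced
by `t^{(i)}_k + c w^k / k`, and the other times stay. The extra variable `none` is `w`. -/
def miwa (i : Fin 3) (c : ℂ) (f : TSeries) : PowerSeries TSeries :=
  MvPowerSeries.optionEquivLeft Time ℂ
    (MvPowerSeries.subst
      (fun s : Time =>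
        (MvPowerSeries.X (some s) +
          if s.1 = i then
            MvPowerSeries.C (c / ((s.2 : ℂ) + 1)) * MvPowerSeries.X none ^ (s.2 + 1)
          else 0 : MvPowerSeries (Option Time) ℂ))
      f)

/-- `f(t)` as a series in `t` and `t'`. -/
def inT (f : TSeries) : TTSeries :=
  MvPowerSeries.subst (fun s : Time => (MvPowerSeries.X (Sum.inl s) : TTSeries)) f

/-- `f(t')` as a series in `t` and `t'`. -/
def inT' (f : TSeries) : TTSeries :=
  MvPowerSeries.subst (fun s : Time => (MvPowerSeries.X (Sum.inr s) : TTSeries)) f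

/-- `ξ(t^{(i)} - t'^{(i)}, w) = ∑_{k ≥ 1} (t^{(i)}_k - t'^{(i)}_k) w^k`. -/
def xi (i : Fin 3) : PowerSeries TTSeries :=
  PowerSeries.mk fun k =>
    match k with
    | 0 => 0
    | k + 1 => MvPowerSeries.X (Sum.inl (i, k)) - MvPowerSeries.X (Sum.inr (i, k))

/-- `exp ξ(t^{(i)} - t'^{(i)}, w) = ∑_n ξ^n / n!`; only `n ≤ r` contributes to `w^r`. -/
def expXi (i : Fin 3) : PowerSeries TTSeries :=
  PowerSeries.mk fun r =>
    ∑ n ∈ Finset.range (r + 1), ((n.factorial : ℂ)⁻¹) • PowerSeries.coeff r (xi i ^ n)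

/-- The coefficient of `z^{-1}` in
`z^a exp(ξ(t^{(i)} - t'^{(i)}, z^s)) f(t - [z^{-s}]_i) g(t' + [z^{-s}]_i)`.
For `s = 1` it is the integral over a large circle and for `s = -1` the integral over a small
circle, with the measure `dz / (2πi)`. The terms with `z^{-1}` are indexed by the triples of
exponents `(r, p, q)` with `a + s (r - p - q) = -1`; each monomial in `t, t'` receives
contributions from finitely many of them. -/
def residue (i : Fin 3) (s : ℤˣ) (a : ℤ) (f g : TSeries) : TTSeries := fun d =>
  ∑ᶠ x : ℕ × ℕ × ℕ,
    if a + s * ((x.1 : ℤ) - x.2.1 - x.2.2) = -1 then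
      MvPowerSeries.coeff d
        (PowerSeries.coeff x.1 (expXi i) *
          inT (PowerSeries.coeff x.2.1 (miwa i (-1) f)) *
          inT' (PowerSeries.coeff x.2.2 (miwa i 1 g)))
    else 0

/-- The bilinear equations of the `[n₁, n₂, n₃]`-KdV hierarchy for the family `τ`, with
`n 0, n 1, n 2` standing for `n₁, n₂, n₃`. -/
def IsKdVTau (n : Fin 3 → ℕ) (τ : ZLat → TSeries) : Prop :=
  ∀ (l : ℕ) (m m' : ZLat),
    residue 0 1 (n 0 * l + m 0 - m' 0) (τ m) (τ m') =
      residue 1 (-1) (-(n 1 * l) + m 1 - m' 1) (τ (m + e₁₂)) (τ (m' - e₁₂)) +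
      ((-1 : ℂ) ^ (m 1 + m' 1)) •
        residue 2 (-1) (-(n 2 * l) + m 0 - m 1 - m' 0 + m' 1) (τ (m + e₁)) (τ (m' - e₁))

/-! ### Wave operators and Lax operators -/

section Lax

variable (τ : ZLat → TSeries)

/-- The coefficient of `w^k` in `f(t - [w]_i) / τ_m(t)`. -/
def waveCoeff (i : Fin 3) (f : TSeries) (m : ZLat) (k : ℕ) : TField :=
  algebraMap TSeries TField (PowerSeries.coeff k (miwa i (-1) f)) /
    algebraMap TSeries TField (τ m)

/-- `S₁(Λ₁) = ∑_k a_k(m) Λ₁^{-k}` with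
`∑_k a_k(m) z^{-k} = τ_m(t - [z⁻¹]_1) / τ_m(t)`. -/
def S₁ : FOp TField := fun j m =>
  if j 0 ≤ 0 ∧ j 1 = 0 then waveCoeff τ 0 (τ m) m (-j 0).toNat else 0

/-- `S₂(Λ₂) = ∑_k a_k(m) Λ₂^k` with `∑_k a_k(m) z^k = τ_{m+e}(t - [z]_2) / τ_m(t)`. -/
def S₂ : FOp TField := fun j m =>
  if j 0 = 0 ∧ 0 ≤ j 1 then waveCoeff τ 1 (τ (m + e₁₂)) m (j 1).toNat else 0

/-- The coefficients of
`∑_k a_k(m) z^k = (-1)^{m₂} τ_{m+e₁}(t - [z]_3) / τ_m(t)`. -/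
def s₃ (k : ℕ) (m : ZLat) : TField := (-1) ^ (m 1) * waveCoeff τ 2 (τ (m + e₁)) m k

/-- `S₃(Λ₁) = ∑_k a_k(m) Λ₁^k`, with the coefficients `s₃`. -/
def S₃ : FOp TField := fun j m => if 0 ≤ j 0 ∧ j 1 = 0 then s₃ τ (j 0).toNat m else 0

/-- `S₃(Λ₂⁻¹) = ∑_k a_k(m) Λ₂^{-k}`, with the coefficients `s₃`. -/
def S₃' : FOp TField := fun j m => if j 0 = 0 ∧ j 1 ≤ 0 then s₃ τ (-j 1).toNat m else 0

/-- `L₁(Λ₁) = S₁(Λ₁) Λ₁ S₁(Λ₁)⁻¹`, with the inverse in `𝓑((Λ₁⁻¹))`. -/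
def L₁ : FOp TField := S₁ τ * shift e₁ * invIn (opEα0 TField 0 1) (S₁ τ)

/-- `L₂(Λ₂) = S₂(Λ₂) Λ₂⁻¹ S₂(Λ₂)⁻¹`, with the inverse in `𝓑((Λ₂))`. -/
def L₂ : FOp TField := S₂ τ * shift (-e₂) * invIn (opEα0 TField 1 (-1)) (S₂ τ)

/-- `L₃(Λ₁) = S₃(Λ₁) Λ₁⁻¹ S₃(Λ₁)⁻¹`, with the inverse in `𝓑((Λ₁))`. -/
def L₃ : FOp TField := S₃ τ * shift (-e₁) * invIn (opEα0 TField 0 (-1)) (S₃ τ)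

/-- `L₃(Λ₂⁻¹) = S₃(Λ₂⁻¹) Λ₂ S₃(Λ₂⁻¹)⁻¹`, with the inverse in `𝓑((Λ₂⁻¹))`. -/
def L₃' : FOp TField := S₃' τ * shift e₂ * invIn (opEα0 TField 1 1) (S₃' τ)

/-- `B_k^{(1)}(Λ₁) = (L₁^k)_{1,≥0}`. -/
def B₁ (k : ℕ) : FOp TField := nonnegPart₁ (L₁ τ ^ k)

/-- `B_k^{(2)}(Λ₂) = (L₂^k)_{Δ₂^*,≥1}`. -/
def B₂ (k : ℕ) : FOp TField := deltaPosPart (-1) (L₂ τ ^ k)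

/-- `B_k^{(3)}(Λ₁) = (L₃(Λ₁)^k)_{1,<0}`. -/
def B₃ (k : ℕ) : FOp TField := negPart₁ (L₃ τ ^ k)

/-- `B_k^{(3)}(Λ₂⁻¹) = (L₃(Λ₂⁻¹)^k)_{Δ₂,≥1}`. -/
def B₃' (k : ℕ) : FOp TField := deltaPosPart 1 (L₃' τ ^ k)

/-- The Lax operator `𝓛`. -/
def laxOp (n : Fin 3 → ℕ) : FOp TField := B₁ τ (n 0) + B₂ τ (n 1) + B₃ τ (n 2)

/-- The Lax operator `𝓛̃`. -/
def laxOp' (n : Fin 3 → ℕ) : FOp TField := B₁ τ (n 0) + B₂ τ (n 1) + B₃' τ (n 2)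

/-- `ρ(m) = τ_m τ_{m+e+e₁} / (τ_{m+e₁} τ_{m+e})`. -/
def rho (m : ZLat) : TField :=
  algebraMap TSeries TField (τ m) / algebraMap TSeries TField (τ (m + e₁)) *
    (algebraMap TSeries TField (τ (m + e₁₂ + e₁)) / algebraMap TSeries TField (τ (m + e₁₂)))

/-- `H = Λ₁ Δ₂ + ρ`. -/
def H : FOp TField := shift e₁ * (shift e₂ - 1) + scalar (rho τ)

end Lax

end ThreeKP

end

open ThreeKP

/-!
At `t' = t` the bilinear equations with `l = 0` and `l = 1` become relations `W₁ = W₂ + W₃` and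
`L₁^{n₁} W₁ = L₂^{n₂} W₂ + L₃^{n₃} W₃` between three bilateral series `W_k` in `Λ₁` and `Λ₂`, the
products of a wave function with its dual: a Lax operator acts on its own series by raising the
exponent of `z`. Here `L₃` may be expanded in either shift. By its support, each truncated part in
`𝓛` and `𝓛̃`, and likewise `H`, multiplies every `W_k` as the corresponding power of a Lax operator
or as `0`, up to an error confined to a region of exponents. Comparing the regions on the two sides
of the relation shows that the error on `W_k` has no terms of order zero in one of the shifts, and
such an error is zero. Hence `H W_k = 0` and `𝓛 W_k = 𝓛̃ W_k = L_k^{n_k} W_k`.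

Since `H` has order one in the shift other than `Λ_α`, with invertible coefficients, every operator
is congruent modulo its left multiples to one in `𝓔_(α)^{0,ε}`. The part of `W_k` of order zero in
the other shift is invertible, so an element of `𝓔_(α)^{0,ε}` is determined by its product with
`W_k`. This gives uniqueness of the decomposition and identifies the projections.
-/

noncomputable section

namespace ThreeKP

open FOp

section FormalOperators

variable {K : Type} [Field K]

namespace FOp

@[ext]
theorem ext {K : Type} {A B : FOp K} (h : ∀ j m, A j m = B j m) : A = B :=
  funext fun j => funext (h j)

theorem add_apply (A B : FOp K) (j m : ZLat) : (A + B) j m = A j m + B j m := rfl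

theorem sub_apply (A B : FOp K) (j m : ZLat) : (A - B) j m = A j m - B j m := rfl

theorem mul_apply (A B : FOp K) (j m : ZLat) :
    (A * B) j m = ∑ᶠ i : ZLat, A i m * B (j - i) (m + i) := rfl

theorem scalar_apply (f : ZLat → K) (j m : ZLat) : scalar f j m = if j = 0 then f m else 0 := rfl

theorem shift_apply (i j m : ZLat) : (shift i : FOp K) j m = if j = i then 1 else 0 := rfl

theorem scalar_mul_apply (f : ZLat → K) (B : FOp K) (j m : ZLat) :
    (scalar f * B) j m = f m * B j m := by
  rw [mul_apply, finsum_eq_single _ 0]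
  · simp [scalar_apply]
  · intro i hi
    simp [scalar_apply, hi]

theorem shift_mul_apply (i : ZLat) (B : FOp K) (j m : ZLat) :
    (shift i * B : FOp K) j m = B (j - i) (m + i) := by
  rw [mul_apply, finsum_eq_single _ i]
  · simp [shift_apply]
  · intro k hk
    simp [shift_apply, hk]

theorem mul_shift_apply (A : FOp K) (i j m : ZLat) : (A * shift i : FOp K) j m = A (j - i) m := by
  rw [mul_apply, finsum_eq_single _ (j - i)]
  · simp [shift_apply]
  · intro k hk
    rw [shift_apply, if_neg (by rintro rfl; simp at hk), mul_zero]

theorem shift_zero : (shift 0 : FOp K) = 1 := rfl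

theorem shift_mul_shift (i j : ZLat) : (shift i * shift j : FOp K) = shift (i + j) := by
  ext k m
  simp only [shift_mul_apply, shift_apply, sub_eq_iff_eq_add, add_comm]

instance : MulZeroOneClass (FOp K) where
  one_mul A := by
    ext j m
    exact (scalar_mul_apply 1 A j m).trans (one_mul _)
  mul_one A := by
    ext j m
    rw [← shift_zero, mul_shift_apply, sub_zero]
  zero_mul _ := by
    ext
    exact (finsum_congr fun _ => zero_mul _).trans finsum_zero
  mul_zero _ := by
    ext
    exact (finsum_congr fun _ => mul_zero _).trans finsum_zero

/-- The sums defining the coefficients of `A * B` have finitely many nonzero terms. -/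
def Composable (A B : FOp K) : Prop := ∀ j, {i | A i ≠ 0 ∧ B (j - i) ≠ 0}.Finite

namespace Composable

variable {A B C : FOp K}

theorem hasFiniteSupport (h : Composable A B) (j m : ZLat) :
    Function.HasFiniteSupport fun i => A i m * B (j - i) (m + i) :=
  (h j).subset fun _ hi =>
    ⟨fun h0 => left_ne_zero_of_mul hi (congrFun h0 _),
      fun h0 => right_ne_zero_of_mul hi (congrFun h0 _)⟩

protected theorem add_mul (hA : Composable A C) (hB : Composable B C) :
    (A + B) * C = A * C + B * C := by
  ext j m
  simp only [add_apply, mul_apply, add_mul]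
  exact finsum_add_distrib (hA.hasFiniteSupport j m) (hB.hasFiniteSupport j m)

protected theorem mul_add (hB : Composable A B) (hC : Composable A C) :
    A * (B + C) = A * B + A * C := by
  ext j m
  simp only [add_apply, mul_apply, mul_add]
  exact finsum_add_distrib (hB.hasFiniteSupport j m) (hC.hasFiniteSupport j m)

end Composable

/-- Both iterated sums are sums over the pairs `(i, k)` of exponents of `A` and `B`. -/
theorem mul_assoc_of_finite {A B C : FOp K}
    (h : ∀ j, {x : ZLat × ZLat | A x.1 ≠ 0 ∧ B x.2 ≠ 0 ∧ C (j - x.1 - x.2) ≠ 0}.Finite) :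
    A * B * C = A * (B * C) := by
  ext j m
  set f : ZLat × ZLat → K := fun x =>
    A x.1 m * (B x.2 (m + x.1) * C (j - x.1 - x.2) (m + x.1 + x.2)) with hf
  have f_finite : Function.HasFiniteSupport f := (h j).subset fun x hx =>
    ⟨fun h0 => hx (by simp [hf, h0]), fun h0 => hx (by simp [hf, h0]),
      fun h0 => hx (by simp [hf, h0])⟩
  have right_eq : (A * (B * C)) j m = ∑ᶠ x, f x := by
    rw [finsum_curry f f_finite, mul_apply]
    exact finsum_congr fun k => by rw [mul_apply, mul_finsum]
  let e : ZLat × ZLat ≃ ZLat × ZLat :=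
    { toFun := fun x => (x.2, x.1 - x.2)
      invFun := fun y => (y.1 + y.2, y.1)
      left_inv := fun x => by simp
      right_inv := fun y => by simp }
  have left_eq : (A * B * C) j m = ∑ᶠ x, f (e x) := by
    rw [finsum_curry (fun x => f (e x)) (f_finite.preimage e.injective.injOn), mul_apply]
    refine finsum_congr fun i => ?_
    rw [mul_apply, finsum_mul]
    refine finsum_congr fun k => ?_
    simp only [hf, e, Equiv.coe_fn_mk]
    rw [mul_assoc, show j - k - (i - k) = j - i by abel, show m + k + (i - k) = m + i by abel]
  rw [left_eq, right_eq, finsum_comp_equiv e]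

/-- The operators whose exponents lie in `s`. -/
def supportedIn (K : Type) [Field K] (s : Set ZLat) : AddSubgroup (FOp K) where
  carrier := {A | ∀ j, j ∉ s → A j = 0}
  add_mem' hA hB j hj := (congrArg₂ (· + ·) (hA j hj) (hB j hj)).trans (add_zero _)
  zero_mem' _ _ := rfl
  neg_mem' hA j hj := (congrArg (-·) (hA j hj)).trans neg_zero

section supportedIn

variable {A B : FOp K} {s t r : Set ZLat}

theorem mem_supportedIn_iff : A ∈ supportedIn K s ↔ ∀ j, A j ≠ 0 → j ∈ s :=
  forall_congr' fun _ => not_imp_comm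

theorem supportedIn_mono (h : s ⊆ t) : supportedIn K s ≤ supportedIn K t :=
  fun _ hA j hj => hA j fun hs => hj (h hs)

theorem mul_mem_supportedIn (hA : A ∈ supportedIn K s) (hB : B ∈ supportedIn K t)
    (h : ∀ i ∈ s, ∀ k ∈ t, i + k ∈ r) : A * B ∈ supportedIn K r := by
  refine fun j hj => funext fun m => (finsum_congr fun i => ?_).trans finsum_zero
  by_cases hi : i ∈ s
  · rw [hB (j - i) fun hk => hj (by simpa using h i hi _ hk), Pi.zero_apply, mul_zero]
  · rw [hA i hi, Pi.zero_apply, zero_mul]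

theorem shift_mem_supportedIn {i : ZLat} (hi : i ∈ s) : shift i ∈ supportedIn K s :=
  fun _ hj => funext fun _ => if_neg (ne_of_mem_of_not_mem hi hj).symm

theorem scalar_mem_supportedIn (hs : 0 ∈ s) (f : ZLat → K) : scalar f ∈ supportedIn K s :=
  fun _ hj => funext fun _ => if_neg (ne_of_mem_of_not_mem hs hj).symm

end supportedIn

end FOp

end FormalOperators

section OpRing

variable {K : Type} [Field K] {α : Fin 2} {ε : ℤˣ} {w : ZLat}

theorem forall_ne_iff {P : Fin 2 → Prop} : (∀ β, β ≠ α → P β) ↔ P (1 - α) := by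
  fin_cases α <;> simp [Fin.forall_fin_two]

theorem dotProduct_eq (w j : ZLat) : w ⬝ᵥ j = w α * j α + w (1 - α) * j (1 - α) := by
  fin_cases α <;> simp [dotProduct, Fin.sum_univ_two, add_comm]

theorem finite_setOf_abs_le (α : Fin 2) (N : ℤ) :
    {j : ZLat | |j α| ≤ N ∧ |j (1 - α)| ≤ N}.Finite := by
  refine (Set.finite_Icc (fun _ => -N : ZLat) fun _ => N).subset fun j hj => ?_
  have h (β : Fin 2) : |j β| ≤ N := by
    by_cases hβ : β = α
    · exact hβ ▸ hj.1
    · exact forall_ne_iff (P := fun β => |j β| ≤ N).2 hj.2 β hβ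
  exact ⟨fun β => (abs_le.1 (h β)).1, fun β => (abs_le.1 (h β)).2⟩

/-- The exponents allowed in `𝓔_(α)^ε` by the bound `N`. -/
def halfStrip (α : Fin 2) (ε : ℤˣ) (N : ℤ) : Set ZLat := {j | ε * j α ≤ N ∧ |j (1 - α)| ≤ N}

theorem halfStrip_mono : Monotone (halfStrip α ε) :=
  fun _ _ h _ hj => ⟨hj.1.trans h, hj.2.trans h⟩

theorem add_mem_halfStrip {N M : ℤ} {i k : ZLat} (hi : i ∈ halfStrip α ε N)
    (hk : k ∈ halfStrip α ε M) : i + k ∈ halfStrip α ε (N + M) := by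
  refine ⟨?_, (abs_add_le _ _).trans (add_le_add hi.2 hk.2)⟩
  rw [Pi.add_apply, mul_add]
  exact add_le_add hi.1 hk.1

theorem mem_halfStrip_self (j : ZLat) : j ∈ halfStrip α ε (|j α| + |j (1 - α)|) := by
  refine ⟨le_add_of_le_of_nonneg ((le_abs_self _).trans_eq ?_) (abs_nonneg _),
    le_add_of_nonneg_left (abs_nonneg _)⟩
  rw [abs_mul, Int.isUnit_iff_abs_eq.1 ε.isUnit, one_mul]

theorem abs_mul_le_of_mem_halfStrip (c : ℤ) {N : ℤ} {j : ZLat} (hj : j ∈ halfStrip α ε N) :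
    |c * j (1 - α)| ≤ |c| * N := by
  rw [abs_mul]
  exact mul_le_mul_of_nonneg_left hj.2 (abs_nonneg c)

theorem le_dotProduct_of_mem_halfStrip (hw : w α = -ε) {N : ℤ} {j : ZLat}
    (hj : j ∈ halfStrip α ε N) : -N - |w (1 - α)| * N ≤ w ⬝ᵥ j := by
  rw [dotProduct_eq (α := α), hw]
  linarith [hj.1, (abs_le.1 (abs_mul_le_of_mem_halfStrip (w (1 - α)) hj)).1]

theorem finite_halfStrip_inter (hw : w α = -ε) (N M : ℤ) :
    {j | j ∈ halfStrip α ε N ∧ w ⬝ᵥ j ≤ M}.Finite := by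
  refine (finite_setOf_abs_le α (|N| + |M| + |w (1 - α)| * N)).subset fun j hj => ?_
  have hN : 0 ≤ |w (1 - α)| * N := mul_nonneg (abs_nonneg _) ((abs_nonneg _).trans hj.1.2)
  have hw' := (abs_le.1 (abs_mul_le_of_mem_halfStrip (w (1 - α)) hj.1)).1
  have hM := hj.2
  rw [dotProduct_eq (α := α), hw] at hM
  have hα : |j α| = |(ε : ℤ) * j α| := by rw [abs_mul, Int.isUnit_iff_abs_eq.1 ε.isUnit, one_mul]
  refine ⟨hα.trans_le (abs_le.2 ⟨?_, ?_⟩), hj.1.2.trans ?_⟩ <;>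
    linarith [hj.1.1, le_abs_self N, le_abs_self M, abs_nonneg N, abs_nonneg M]

theorem mem_opEα_iff {A : FOp K} :
    A ∈ opEα K α ε ↔ ∃ N, A ∈ supportedIn K (halfStrip α ε N) := by
  refine exists_congr fun N => forall_congr' fun j => imp_congr_left ?_
  rw [← not_iff_not]
  push Not
  exact and_congr_right' (forall_ne_iff (P := fun β => |j β| ≤ N))

variable (K α ε) in
/-- The ring `𝓔_(α)^ε`. -/
def OpRing : AddSubgroup (FOp K) where
  carrier := opEα K α ε
  add_mem' hA hB := by
    obtain ⟨N, hN⟩ := mem_opEα_iff.1 hA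
    obtain ⟨M, hM⟩ := mem_opEα_iff.1 hB
    exact mem_opEα_iff.2 ⟨max N M, add_mem
      (supportedIn_mono (halfStrip_mono (le_max_left N M)) hN)
      (supportedIn_mono (halfStrip_mono (le_max_right N M)) hM)⟩
  zero_mem' := mem_opEα_iff.2 ⟨0, zero_mem _⟩
  neg_mem' hA := by
    obtain ⟨N, hN⟩ := mem_opEα_iff.1 hA
    exact mem_opEα_iff.2 ⟨N, neg_mem hN⟩

variable (K w) in
/-- The formal series `∑_j a_j(m) Λ^j` for which `w ⬝ᵥ j` is bounded below. If `w α = -ε`, then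
the elements of `𝓔_(α)^ε` can be multiplied by them. -/
def SeriesModule : AddSubgroup (FOp K) where
  carrier := {A | ∃ N, A ∈ supportedIn K {j | N ≤ w ⬝ᵥ j}}
  add_mem' := fun ⟨N, hN⟩ ⟨M, hM⟩ => ⟨min N M, add_mem
    (supportedIn_mono (fun _ hj => (min_le_left N M).trans hj) hN)
    (supportedIn_mono (fun _ hj => (min_le_right N M).trans hj) hM)⟩
  zero_mem' := ⟨0, zero_mem _⟩
  neg_mem' := fun ⟨N, hN⟩ => ⟨N, neg_mem hN⟩

theorem mem_OpRing_iff {A : FOp K} :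
    A ∈ OpRing K α ε ↔ ∃ N, A ∈ supportedIn K (halfStrip α ε N) := mem_opEα_iff

theorem opRing_le_seriesModule (hw : w α = -ε) : OpRing K α ε ≤ SeriesModule K w := fun A hA => by
  obtain ⟨N, hN⟩ := mem_OpRing_iff.1 hA
  exact ⟨_, supportedIn_mono (fun _ => le_dotProduct_of_mem_halfStrip hw) hN⟩

section Products

variable {A B C : FOp K}

theorem mul_mem_OpRing (hA : A ∈ OpRing K α ε) (hB : B ∈ OpRing K α ε) :
    A * B ∈ OpRing K α ε := by
  obtain ⟨N, hN⟩ := mem_OpRing_iff.1 hA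
  obtain ⟨M, hM⟩ := mem_OpRing_iff.1 hB
  exact mem_OpRing_iff.2
    ⟨N + M, mul_mem_supportedIn hN hM fun _ hi _ hk => add_mem_halfStrip hi hk⟩

theorem mul_mem_SeriesModule (hw : w α = -ε) (hA : A ∈ OpRing K α ε) (hC : C ∈ SeriesModule K w) :
    A * C ∈ SeriesModule K w := by
  obtain ⟨N, hN⟩ := opRing_le_seriesModule hw hA
  obtain ⟨M, hM⟩ := hC
  refine ⟨N + M, mul_mem_supportedIn hN hM fun i hi k hk => ?_⟩
  rw [Set.mem_ofPred_eq, dotProduct_add]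
  exact add_le_add hi hk

theorem composable_of_mem (hw : w α = -ε) (hA : A ∈ OpRing K α ε) (hC : C ∈ SeriesModule K w) :
    Composable A C := by
  obtain ⟨N, hN⟩ := mem_OpRing_iff.1 hA
  obtain ⟨M, hM⟩ := hC
  refine fun j => (finite_halfStrip_inter hw N (w ⬝ᵥ j - M)).subset fun i hi =>
    ⟨mem_supportedIn_iff.1 hN i hi.1, ?_⟩
  have hji : M ≤ w ⬝ᵥ (j - i) := mem_supportedIn_iff.1 hM _ hi.2
  rw [dotProduct_sub] at hji
  linarith

theorem mul_assoc_of_mem (hw : w α = -ε) (hA : A ∈ OpRing K α ε) (hB : B ∈ OpRing K α ε)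
    (hC : C ∈ SeriesModule K w) : A * B * C = A * (B * C) := by
  obtain ⟨N, hN⟩ := mem_OpRing_iff.1 hA
  obtain ⟨N', hN'⟩ := mem_OpRing_iff.1 hB
  obtain ⟨D, hD⟩ := opRing_le_seriesModule hw hA
  obtain ⟨D', hD'⟩ := opRing_le_seriesModule hw hB
  obtain ⟨M, hM⟩ := hC
  refine mul_assoc_of_finite fun j => ((finite_halfStrip_inter hw N (w ⬝ᵥ j - M - D')).prod
    (finite_halfStrip_inter hw N' (w ⬝ᵥ j - M - D))).subset ?_
  rintro ⟨i, k⟩ ⟨hi, hk, hjik⟩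
  have h₁ : D ≤ w ⬝ᵥ i := mem_supportedIn_iff.1 hD i hi
  have h₂ : D' ≤ w ⬝ᵥ k := mem_supportedIn_iff.1 hD' k hk
  have h₃ : M ≤ w ⬝ᵥ (j - i - k) := mem_supportedIn_iff.1 hM _ hjik
  rw [dotProduct_sub, dotProduct_sub] at h₃
  exact ⟨⟨mem_supportedIn_iff.1 hN i hi, by linarith⟩,
    ⟨mem_supportedIn_iff.1 hN' k hk, by linarith⟩⟩

end Products

theorem shift_mem_OpRing (i : ZLat) : shift i ∈ OpRing K α ε :=
  mem_OpRing_iff.2 ⟨_, shift_mem_supportedIn (mem_halfStrip_self i)⟩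

theorem scalar_mem_OpRing (f : ZLat → K) : scalar f ∈ OpRing K α ε :=
  mem_OpRing_iff.2 ⟨_, scalar_mem_supportedIn (mem_halfStrip_self 0) f⟩

/-- The exponent of `Λ_α^{-ε}`, so that `𝓔_(α)^{0,ε}` consists of the Laurent series in `Λ^dir`.
It is also a weight for which `𝓔_(α)^ε` acts on itself. -/
def dir (α : Fin 2) (ε : ℤˣ) : ZLat := Pi.single α (-(ε : ℤ))

theorem dir_self : dir α ε α = -ε := Pi.single_eq_same _ _

instance : Ring (OpRing K α ε) :=
  have hle := opRing_le_seriesModule (K := K) (dir_self (α := α) (ε := ε))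
  { (inferInstance : AddCommGroup (OpRing K α ε)) with
    mul A B := ⟨A.1 * B.1, mul_mem_OpRing A.2 B.2⟩
    one := ⟨1, shift_mem_OpRing 0⟩
    mul_assoc A B C := Subtype.ext (mul_assoc_of_mem dir_self A.2 B.2 (hle C.2))
    one_mul A := Subtype.ext (one_mul A.1)
    mul_one A := Subtype.ext (mul_one A.1)
    zero_mul A := Subtype.ext (zero_mul A.1)
    mul_zero A := Subtype.ext (mul_zero A.1)
    left_distrib A B C := Subtype.ext
      ((composable_of_mem dir_self A.2 (hle B.2)).mul_add
        (composable_of_mem dir_self A.2 (hle C.2)))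
    right_distrib A B C := Subtype.ext
      ((composable_of_mem dir_self A.2 (hle C.2)).add_mul
        (composable_of_mem dir_self B.2 (hle C.2))) }

namespace OpRing

theorem coe_mul (A B : OpRing K α ε) : ((A * B : OpRing K α ε) : FOp K) = A * B := rfl

theorem coe_pow (A : OpRing K α ε) (n : ℕ) :
    ((A ^ n : OpRing K α ε) : FOp K) = (A : FOp K) ^ n := by
  induction n with
  | zero => rw [pow_zero]; rfl
  | succ n ih => rw [pow_succ, coe_mul, ih]; rfl

end OpRing

instance [hw : Fact (w α = -ε)] : Module (OpRing K α ε) (SeriesModule K w) where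
  smul A C := ⟨A.1 * C.1, mul_mem_SeriesModule hw.1 A.2 C.2⟩
  one_smul C := Subtype.ext (one_mul C.1)
  mul_smul A B C := Subtype.ext (mul_assoc_of_mem hw.1 A.2 B.2 C.2)
  smul_zero A := Subtype.ext (mul_zero A.1)
  smul_add A C D := Subtype.ext
    ((composable_of_mem hw.1 A.2 C.2).mul_add (composable_of_mem hw.1 A.2 D.2))
  add_smul A B C := Subtype.ext
    ((composable_of_mem hw.1 A.2 C.2).add_mul (composable_of_mem hw.1 B.2 C.2))
  zero_smul C := Subtype.ext (zero_mul C.1)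

end OpRing

section Division

variable {K : Type} [Field K] {α : Fin 2} {ε : ℤˣ} {w : ZLat}

theorem FOp.sum_apply {ι : Type*} (s : Finset ι) (A : ι → FOp K) (j m : ZLat) :
    (∑ i ∈ s, A i) j m = ∑ i ∈ s, A i j m := by
  induction s using Finset.cons_induction with
  | empty => rfl
  | cons a s ha ih => rw [Finset.sum_cons, Finset.sum_cons, FOp.add_apply, ih]

/-- The exponents of the monomials in `Λ_α` alone. -/
def axis (α : Fin 2) : Set ZLat := {j | j (1 - α) = 0}

theorem add_mem_axis {i k : ZLat} (hi : i ∈ axis α) (hk : k ∈ axis α) : i + k ∈ axis α := by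
  rw [axis, Set.mem_ofPred_eq, Pi.add_apply, hi, hk, add_zero]

theorem add_mem_axis_iff {i k : ZLat} (hi : i ∈ axis α) : i + k ∈ axis α ↔ k ∈ axis α := by
  rw [axis, Set.mem_ofPred_eq, Pi.add_apply, hi, zero_add, Set.mem_ofPred_eq]

variable (K α ε) in
/-- The subring `𝓔_(α)^{0,ε}` of `𝓔_(α)^ε`. -/
def laurentSubring : Subring (OpRing K α ε) where
  carrier := {A | A.1 ∈ supportedIn K (axis α)}
  mul_mem' hA hB := mul_mem_supportedIn hA hB fun _ hi _ hk => add_mem_axis hi hk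
  one_mem' := scalar_mem_supportedIn (show (0 : ZLat) ∈ axis α from rfl) 1
  add_mem' hA hB := (supportedIn K (axis α)).add_mem hA hB
  zero_mem' := (supportedIn K (axis α)).zero_mem
  neg_mem' hA := (supportedIn K (axis α)).neg_mem hA

theorem mem_laurentSubring_iff {A : OpRing K α ε} :
    A ∈ laurentSubring K α ε ↔ (A : FOp K) ∈ supportedIn K (axis α) := Iff.rfl

theorem laurentSubring.coe_mul (P Q : laurentSubring K α ε) :
    ((P * Q : laurentSubring K α ε) : FOp K) = P * Q := rfl

theorem mem_opEα0_iff {A : FOp K} :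
    A ∈ opEα0 K α ε ↔ ∃ P : laurentSubring K α ε, (P : FOp K) = A := by
  have key : (∀ j : ZLat, (∃ β, β ≠ α ∧ j β ≠ 0) → A j = 0) ↔ A ∈ supportedIn K (axis α) := by
    refine forall_congr' fun j => imp_congr_left ?_
    rw [← not_iff_not]
    push Not
    exact forall_ne_iff (P := fun β => j β = 0)
  constructor
  · rintro ⟨hA, hA₀⟩
    exact ⟨⟨⟨A, hA⟩, mem_laurentSubring_iff.2 (key.1 hA₀)⟩, rfl⟩
  · rintro ⟨P, rfl⟩
    exact ⟨P.1.2, key.2 (mem_laurentSubring_iff.1 P.2)⟩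

/-! ### The part of order zero in the other shift operator -/

variable (α) in
/-- The terms of a series that contain no shift operator other than `Λ_α`. -/
def row (C : FOp K) : FOp K := fun j m => if j (1 - α) = 0 then C j m else 0

theorem row_mem_axis (C : FOp K) : row α C ∈ supportedIn K (axis α) :=
  fun _ hj => funext fun _ => if_neg hj

theorem row_mem_OpRing (hw : w α = -ε) {C : FOp K} (hC : C ∈ SeriesModule K w) :
    row α C ∈ OpRing K α ε := by
  obtain ⟨N, hN⟩ := hC
  refine mem_OpRing_iff.2 ⟨|N|, mem_supportedIn_iff.2 fun j hj => ?_⟩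
  have hj₀ : j (1 - α) = 0 := mem_supportedIn_iff.1 (row_mem_axis C) j hj
  have hjN : N ≤ w ⬝ᵥ j := mem_supportedIn_iff.1 hN j fun h => hj <| by
    ext m
    rw [row, h]
    exact ite_self 0
  rw [dotProduct_eq (α := α), hw, hj₀] at hjN
  refine ⟨by linarith [neg_abs_le N], ?_⟩
  rw [hj₀, abs_zero]
  exact abs_nonneg N

theorem row_mul {P : FOp K} (hP : P ∈ supportedIn K (axis α)) (C : FOp K) :
    row α (P * C) = P * row α C := by
  ext j m
  rw [row, mul_apply, mul_apply]
  have h (i : ZLat) : P i m * row α C (j - i) (m + i) =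
      if j (1 - α) = 0 then P i m * C (j - i) (m + i) else 0 := by
    by_cases hi : i ∈ axis α
    · rw [row, mul_ite, mul_zero]
      have h_iff : j - i ∈ axis α ↔ j ∈ axis α := by
        rw [← add_mem_axis_iff hi, add_sub_cancel]
      exact if_congr h_iff rfl rfl
    · rw [hP i hi, Pi.zero_apply, zero_mul, zero_mul, ite_self]
  simp only [h]
  split_ifs
  · rfl
  · exact finsum_zero.symm

variable (α ε) in
/-- `row` as a linear map over `𝓔_(α)^{0,ε}`. -/
def rowMap [hw : Fact (w α = -ε)] :
    SeriesModule K w →ₗ[laurentSubring K α ε] laurentSubring K α ε where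
  toFun C :=
    ⟨⟨row α C.1, row_mem_OpRing hw.1 C.2⟩, mem_laurentSubring_iff.2 (row_mem_axis C.1)⟩
  map_add' C D := by
    refine Subtype.ext (Subtype.ext (FOp.ext fun j m => ?_))
    exact (ite_congr rfl (fun _ => rfl) fun _ => (add_zero 0).symm).trans
      (ite_add_ite _ _ _ _ _).symm
  map_smul' P C := Subtype.ext (Subtype.ext (row_mul (mem_laurentSubring_iff.1 P.2) C.1))

theorem eq_of_smul_eq_smul [Fact (w α = -ε)] {P P' : laurentSubring K α ε} {Z : SeriesModule K w}
    (hZ : IsUnit (rowMap α ε Z)) (h : P • Z = P' • Z) : P = P' := by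
  have h_row := congrArg (rowMap α ε) h
  rwa [map_smul, map_smul, smul_eq_mul, smul_eq_mul, hZ.mul_left_inj] at h_row

/-! ### Expansion in the other shift operator -/

variable (K α ε) in
/-- The monomials `Λ^i` as units of `𝓔_(α)^ε`. -/
def monomial : Multiplicative ZLat →* (OpRing K α ε)ˣ :=
  MonoidHom.toHomUnits
    { toFun i := ⟨shift i.toAdd, shift_mem_OpRing _⟩
      map_one' := rfl
      map_mul' i k := Subtype.ext (shift_mul_shift i.toAdd k.toAdd).symm }

variable (K α ε) in
/-- The shift operator other than `Λ_α`. -/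
def otherShift : (OpRing K α ε)ˣ := monomial K α ε (.ofAdd (Pi.single (1 - α) 1))

theorem coe_otherShift_zpow (r : ℤ) :
    (((otherShift K α ε ^ r : (OpRing K α ε)ˣ) : OpRing K α ε) : FOp K) =
      shift (Pi.single (1 - α) r) := by
  rw [otherShift, ← map_zpow, ← ofAdd_zsmul, ← Pi.single_smul, zsmul_one]
  rfl

theorem mul_otherShift_zpow_apply (A : OpRing K α ε) (r : ℤ) (j m : ZLat) :
    ((A * (otherShift K α ε ^ r : (OpRing K α ε)ˣ) : OpRing K α ε) : FOp K) j m =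
      A.1 (j - Pi.single (1 - α) r) m := by
  rw [OpRing.coe_mul, coe_otherShift_zpow, mul_shift_apply]

/-- The coefficient `c_r ∈ 𝓔_(α)^{0,ε}` in the expansion of `A` in powers of the shift operator
other than `Λ_α`. -/
def otherCoeff (A : OpRing K α ε) (r : ℤ) : laurentSubring K α ε :=
  have : Fact (dir α ε α = -ε) := ⟨dir_self⟩
  rowMap α ε ⟨_, opRing_le_seriesModule dir_self
    (A * (otherShift K α ε ^ (-r) : (OpRing K α ε)ˣ)).2⟩

theorem otherCoeff_apply (A : OpRing K α ε) (r : ℤ) (j m : ZLat) :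
    (otherCoeff A r : FOp K) j m =
      if j (1 - α) = 0 then A.1 (j + Pi.single (1 - α) r) m else 0 := by
  rw [← sub_neg_eq_add, ← Pi.single_neg, ← mul_otherShift_zpow_apply]
  rfl

theorem exists_eq_sum_otherCoeff (A : OpRing K α ε) : ∃ s : Finset ℤ,
    A = ∑ r ∈ s, (otherCoeff A r : OpRing K α ε) * (otherShift K α ε ^ r : (OpRing K α ε)ˣ) := by
  obtain ⟨N, hN⟩ := mem_OpRing_iff.1 A.2
  refine ⟨Finset.Icc (-N) N, Subtype.ext (FOp.ext fun j m => ?_)⟩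
  have h_term (r : ℤ) :
      (((otherCoeff A r : OpRing K α ε) * (otherShift K α ε ^ r : (OpRing K α ε)ˣ) :
        OpRing K α ε) : FOp K) j m =
        if j (1 - α) = r then A.1 j m else 0 := by
    rw [mul_otherShift_zpow_apply, otherCoeff_apply, sub_add_cancel]
    refine if_congr ?_ rfl rfl
    rw [Pi.sub_apply, Pi.single_eq_same, sub_eq_zero]
  rw [AddSubgroup.val_finsetSum, FOp.sum_apply, Finset.sum_congr rfl fun r _ => h_term r,
    Finset.sum_ite_eq]
  refine (ite_eq_left_iff.2 fun hj => ?_).symm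
  rw [hN j fun h => hj (Finset.mem_Icc.2 (abs_le.1 h.2)), Pi.zero_apply]

/-- If `Z` is invariant under the other shift operator, then `C • Z` only depends on the sum of
the coefficients of `C`. -/
theorem smul_eq_zero_of_rowMap_eq_zero [Fact (w α = -ε)] {Z : SeriesModule K w}
    (h_inv : otherShift K α ε • Z = Z) (hZ : IsUnit (rowMap α ε Z)) (C : OpRing K α ε)
    (h : rowMap α ε (C • Z) = 0) : C • Z = 0 := by
  have h_inv_zpow (r : ℤ) : (otherShift K α ε ^ r : (OpRing K α ε)ˣ) • Z = Z :=
    Subgroup.zpow_mem (MulAction.stabilizer _ Z) h_inv r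
  obtain ⟨s, hs⟩ := exists_eq_sum_otherCoeff C
  have h_smul : C • Z = (∑ r ∈ s, otherCoeff C r) • Z := by
    conv_lhs => rw [hs]
    rw [Finset.sum_smul, Finset.sum_smul]
    refine Finset.sum_congr rfl fun r _ => ?_
    rw [mul_smul, ← Units.smul_def, h_inv_zpow]
    rfl
  rw [h_smul, map_smul, smul_eq_mul, hZ.mul_left_eq_zero] at h
  rw [h_smul, h, zero_smul]

/-! ### Division by an operator of order one in the other shift operator -/

section LeftIdeal

variable {R : Type*} [Ring R] {S : Subring R} {I : Ideal R}

theorem exists_mul_sub_mem {e : Rˣ} (he : ∀ p ∈ S, (e * p * e⁻¹ : R) ∈ S)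
    (he_mem : ∃ p ∈ S, (e : R) - p ∈ I) {a : R} (ha : ∃ p ∈ S, a - p ∈ I) :
    ∃ p ∈ S, e * a - p ∈ I := by
  obtain ⟨q, hq, hqI⟩ := he_mem
  obtain ⟨p, hp, hpI⟩ := ha
  refine ⟨e * p * e⁻¹ * q, mul_mem (he p hp) hq, ?_⟩
  have h : e * a - e * p * e⁻¹ * q = e * (a - p) + e * p * e⁻¹ * ((e : R) - q) := by
    simp only [mul_sub, Units.inv_mul_cancel_right]
    abel
  rw [h]
  exact add_mem (I.mul_mem_left _ hpI) (I.mul_mem_left _ hqI)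

/-- Modulo the left ideal of `x e - y` one has `e ≡ x⁻¹ y` and `e⁻¹ ≡ e⁻¹ (y⁻¹ x) e`. -/
theorem exists_zpow_sub_mem_span {e : Rˣ} (he : ∀ p ∈ S, (e * p * e⁻¹ : R) ∈ S)
    (he' : ∀ p ∈ S, (e⁻¹ * p * e : R) ∈ S) (x y : Sˣ) (r : ℤ) :
    ∃ p ∈ S, ((e ^ r : Rˣ) : R) - p ∈ Ideal.span {((x : S) : R) * e - (y : S)} := by
  set I : Ideal R := Ideal.span {((x : S) : R) * e - (y : S)}
  have h_mem (a : R) : a * (((x : S) : R) * e - (y : S)) ∈ I :=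
    I.mul_mem_left a (Ideal.mem_span_singleton_self _)
  have hx : (((x⁻¹ : Sˣ) : S) : R) * (x : S) = 1 := congrArg Subtype.val x.inv_mul
  have hy : (((y⁻¹ : Sˣ) : S) : R) * (y : S) = 1 := congrArg Subtype.val y.inv_mul
  have h_e : ∃ p ∈ S, (e : R) - p ∈ I := by
    refine ⟨_, ((x⁻¹ : Sˣ) * (y : S) : S).2, ?_⟩
    convert h_mem ((x⁻¹ : Sˣ) : S) using 1
    rw [mul_sub, ← mul_assoc, hx, one_mul]
    rfl
  have h_inv : ∃ p ∈ S, ((e⁻¹ : Rˣ) : R) - p ∈ I := by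
    refine ⟨_, he' _ ((y⁻¹ : Sˣ) * (x : S) : S).2, ?_⟩
    convert h_mem (-(((e⁻¹ : Rˣ) : R) * ((y⁻¹ : Sˣ) : S))) using 1
    rw [neg_mul, mul_sub, mul_assoc _ _ ((y : S) : R), hy, mul_one, neg_sub, Subring.coe_mul]
    simp only [mul_assoc]
  induction r using Int.induction_on with
  | zero => exact ⟨1, one_mem S, by simp⟩
  | succ n ih =>
    rw [add_comm, zpow_add, zpow_one, Units.val_mul]
    exact exists_mul_sub_mem he h_e ih
  | pred n ih =>
    rw [sub_eq_neg_add, zpow_add, zpow_neg_one, Units.val_mul]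
    exact exists_mul_sub_mem (e := e⁻¹) (by rwa [inv_inv]) h_inv ih

end LeftIdeal

theorem conj_monomial_mem (i : Multiplicative ZLat) {P : OpRing K α ε}
    (hP : P ∈ laurentSubring K α ε) :
    (monomial K α ε i * P * ((monomial K α ε i)⁻¹ : (OpRing K α ε)ˣ) : OpRing K α ε) ∈
      laurentSubring K α ε := by
  refine mem_laurentSubring_iff.2 fun j hj => funext fun m => ?_
  rw [← map_inv]
  change (shift i.toAdd * P.1 * shift (-i.toAdd) : FOp K) j m = 0
  rw [mul_shift_apply, shift_mul_apply, sub_neg_eq_add, add_sub_cancel_right, hP j hj,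
    Pi.zero_apply]

theorem exists_sub_mem_span (x y : (laurentSubring K α ε)ˣ) (A : OpRing K α ε) :
    ∃ P : laurentSubring K α ε, A - P ∈ Ideal.span
      {((x : laurentSubring K α ε) : OpRing K α ε) * otherShift K α ε -
        (y : laurentSubring K α ε)} := by
  have h (r : ℤ) := exists_zpow_sub_mem_span (S := laurentSubring K α ε) (e := otherShift K α ε)
    (fun P hP => conj_monomial_mem _ hP)
    (fun P hP => by
      have := conj_monomial_mem (.ofAdd (Pi.single (1 - α) 1))⁻¹ hP
      rwa [map_inv, inv_inv] at this) x y r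
  choose p hp hp_mem using h
  obtain ⟨s, hs⟩ := exists_eq_sum_otherCoeff A
  refine ⟨∑ r ∈ s, otherCoeff A r * ⟨p r, hp r⟩, ?_⟩
  nth_rw 1 [hs]
  rw [AddSubmonoidClass.coe_finsetSum, ← Finset.sum_sub_distrib]
  refine sum_mem fun r _ => ?_
  rw [Subring.coe_mul, ← mul_sub]
  exact Ideal.mul_mem_left _ _ (hp_mem r)

section Annihilated

variable [Fact (w α = -ε)] {D : OpRing K α ε} {Z : SeriesModule K w}

theorem exists_smul_eq_of_decomposition (hDZ : D • Z = 0) {A : OpRing K α ε} {P' : FOp K}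
    (hP' : P' ∈ opEα0 K α ε ∧ ∃ Q ∈ opEα K α ε, (A : FOp K) = P' + Q * D) :
    ∃ P : laurentSubring K α ε, (P : FOp K) = P' ∧ A • Z = P • Z := by
  obtain ⟨hP', Q, hQ, hA⟩ := hP'
  obtain ⟨P, rfl⟩ := mem_opEα0_iff.1 hP'
  have hA' : A = P + ⟨Q, hQ⟩ * D := Subtype.ext hA
  refine ⟨P, rfl, ?_⟩
  rw [hA', add_smul, mul_smul, hDZ, smul_zero, add_zero]
  rfl

theorem directSumDecomposition {x y : (laurentSubring K α ε)ˣ}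
    (hD : D = ((x : laurentSubring K α ε) : OpRing K α ε) * otherShift K α ε -
      (y : laurentSubring K α ε)) (hDZ : D • Z = 0) (hZ : IsUnit (rowMap α ε Z)) :
    DirectSumDecomposition α ε (D : FOp K) := by
  refine ⟨fun P hP => hP.1, fun Q hQ => mul_mem_OpRing hQ D.2, fun A hA => ?_⟩
  obtain ⟨P, hP⟩ := exists_sub_mem_span x y ⟨A, hA⟩
  rw [← hD, Ideal.mem_span_singleton'] at hP
  obtain ⟨Q, hQ⟩ := hP
  have h_dec : A = P + Q * D :=
    congrArg Subtype.val (sub_eq_iff_eq_add'.1 hQ.symm : (⟨A, hA⟩ : OpRing K α ε) = P + Q * D)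
  have hP_dec : (P : FOp K) ∈ opEα0 K α ε ∧ ∃ Q ∈ opEα K α ε, A = P + Q * D :=
    ⟨mem_opEα0_iff.2 ⟨P, rfl⟩, Q, Q.2, h_dec⟩
  refine ⟨P, hP_dec, fun P' hP'_dec => ?_⟩
  obtain ⟨P₁, hP₁, h₁⟩ := exists_smul_eq_of_decomposition (A := ⟨A, hA⟩) hDZ hP_dec
  obtain ⟨P₂, hP₂, h₂⟩ := exists_smul_eq_of_decomposition (A := ⟨A, hA⟩) hDZ hP'_dec
  rw [← hP₁, ← hP₂, eq_of_smul_eq_smul hZ (h₂.symm.trans h₁)]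

theorem proj_eq_of_smul_eq (h_dec : DirectSumDecomposition α ε (D : FOp K)) (hDZ : D • Z = 0)
    (hZ : IsUnit (rowMap α ε Z)) {A : OpRing K α ε} {P : laurentSubring K α ε}
    (h : A • Z = P • Z) : proj α ε (D : FOp K) A = P := by
  obtain ⟨P', hP', h'⟩ := exists_smul_eq_of_decomposition hDZ
    (Classical.epsilon_spec (h_dec.2.2 A A.2).exists)
  rw [proj, ← hP', eq_of_smul_eq_smul hZ (h'.symm.trans h)]

end Annihilated

end Division

section LaurentSeries

variable {K : Type} [Field K] {α : Fin 2} {ε : ℤˣ}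

/-! ### Power series in one shift operator -/

theorem zsmul_dir_self (c : ℤ) : (c • dir α ε) α = -(ε * c) := by
  rw [Pi.smul_apply, dir_self, smul_eq_mul, mul_neg, mul_comm]

theorem zsmul_dir_mem_axis (c : ℤ) : c • dir α ε ∈ axis α := by
  rw [axis, Set.mem_ofPred_eq, Pi.smul_apply, dir, Pi.single_eq_of_ne, smul_zero]
  revert α
  decide

theorem unit_mul_unit_mul (ε : ℤˣ) (c : ℤ) : (ε : ℤ) * (ε * c) = c := by
  rw [← mul_assoc, Int.units_coe_mul_self, one_mul]

theorem neg_unit_mul_zsmul_dir (c : ℤ) : -((ε : ℤ) * (c • dir α ε) α) = c := by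
  rw [zsmul_dir_self, mul_neg, unit_mul_unit_mul, neg_neg]

theorem zsmul_dir_injective : Function.Injective fun c : ℤ => c • dir α ε := fun c d h => by
  rw [← neg_unit_mul_zsmul_dir (α := α) (ε := ε) c, ← neg_unit_mul_zsmul_dir (α := α) (ε := ε) d]
  exact congrArg (fun j : ZLat => -((ε : ℤ) * j α)) h

theorem eq_zsmul_dir {j : ZLat} (hj : j ∈ axis α) : j = (-(ε * j α)) • dir α ε := by
  refine funext fun β => ?_
  by_cases hβ : β = α
  · rw [hβ, zsmul_dir_self, mul_neg, unit_mul_unit_mul, neg_neg]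
  · revert β
    refine forall_ne_iff.2 ?_
    exact hj.trans (zsmul_dir_mem_axis _).symm

theorem laurentSubring_apply_eq_zero (P : laurentSubring K α ε) {j : ZLat} (hj : j ∉ axis α)
    (m : ZLat) : (P : FOp K) j m = 0 :=
  congrFun (mem_laurentSubring_iff.1 P.2 j hj) m

theorem laurentSubring_ext {P Q : laurentSubring K α ε}
    (h : ∀ (c : ℤ) m, (P : FOp K) (c • dir α ε) m = (Q : FOp K) (c • dir α ε) m) : P = Q := by
  refine Subtype.ext (Subtype.ext (FOp.ext fun j m => ?_))
  by_cases hj : j ∈ axis α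
  · rw [eq_zsmul_dir (ε := ε) hj, h]
  · rw [laurentSubring_apply_eq_zero P hj, laurentSubring_apply_eq_zero Q hj]

variable (α ε) in
/-- The operator `∑_k u_k(m) Λ_α^{-εk}`. -/
def seriesOp (u : ℕ → ZLat → K) : FOp K := fun j m =>
  if 0 ≤ -(ε * j α) ∧ j (1 - α) = 0 then u (-(ε * j α)).toNat m else 0

theorem seriesOp_zsmul_dir (u : ℕ → ZLat → K) (c : ℤ) (m : ZLat) :
    seriesOp α ε u (c • dir α ε) m = if 0 ≤ c then u c.toNat m else 0 := by
  rw [seriesOp, neg_unit_mul_zsmul_dir]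
  exact if_congr (and_iff_left (zsmul_dir_mem_axis c)) rfl rfl

theorem seriesOp_nsmul_dir (u : ℕ → ZLat → K) (k : ℕ) (m : ZLat) :
    seriesOp α ε u ((k : ℤ) • dir α ε) m = u k m := by
  rw [seriesOp_zsmul_dir, if_pos (Int.natCast_nonneg k), Int.toNat_natCast]

theorem seriesOp_mem_range (u : ℕ → ZLat → K) :
    seriesOp α ε u ∈ supportedIn K (Set.range fun k : ℕ => (k : ℤ) • dir α ε) := by
  refine fun j hj => funext fun m => if_neg fun h => hj ⟨(-(ε * j α)).toNat, ?_⟩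
  simp only [Int.toNat_of_nonneg h.1, ← eq_zsmul_dir h.2]

theorem seriesOp_mem_OpRing (u : ℕ → ZLat → K) : seriesOp α ε u ∈ OpRing K α ε := by
  refine mem_OpRing_iff.2 ⟨0, supportedIn_mono ?_ (seriesOp_mem_range u)⟩
  rintro _ ⟨k, rfl⟩
  refine ⟨?_, ?_⟩ <;> beta_reduce
  · rw [zsmul_dir_self, mul_neg, unit_mul_unit_mul]
    exact neg_nonpos.2 (Int.natCast_nonneg k)
  · rw [zsmul_dir_mem_axis k, abs_zero]

theorem seriesOp_mem_axis (u : ℕ → ZLat → K) : seriesOp α ε u ∈ supportedIn K (axis α) := by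
  refine supportedIn_mono ?_ (seriesOp_mem_range u)
  rintro _ ⟨k, rfl⟩
  exact zsmul_dir_mem_axis k

variable (α ε) in
/-- `∑_k u_k(m) Λ_α^{-εk}` as an element of `𝓔_(α)^{0,ε}`. -/
def powerSeries (u : ℕ → ZLat → K) : laurentSubring K α ε :=
  ⟨⟨seriesOp α ε u, seriesOp_mem_OpRing u⟩, mem_laurentSubring_iff.2 (seriesOp_mem_axis u)⟩

theorem coe_powerSeries (u : ℕ → ZLat → K) : (powerSeries α ε u : FOp K) = seriesOp α ε u := rfl

theorem seriesOp_mul_apply (u : ℕ → ZLat → K) (C : FOp K) (j m : ZLat) :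
    (seriesOp α ε u * C) j m =
      ∑ᶠ k : ℕ, u k m * C (j - (k : ℤ) • dir α ε) (m + (k : ℤ) • dir α ε) := by
  set f : ZLat → K := fun i => seriesOp α ε u i m * C (j - i) (m + i)
  have hf : Function.support f ⊆ Set.range fun k : ℕ => (k : ℤ) • dir α ε := fun i hi =>
    mem_supportedIn_iff.1 (seriesOp_mem_range u) i fun h =>
      left_ne_zero_of_mul hi (congrFun h m)
  have h_range : ∑ᶠ i, f i = ∑ᶠ k : ℕ, f ((k : ℤ) • dir α ε) := by
    rw [← Set.indicator_eq_self.2 hf, ← finsum_mem_def, Set.indicator_eq_self.2 hf]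
    exact finsum_mem_range (zsmul_dir_injective.comp Nat.cast_injective)
  exact h_range.trans (finsum_congr fun k => by rw [← seriesOp_nsmul_dir (α := α) (ε := ε) u])

theorem powerSeries_mul_powerSeries (u v : ℕ → ZLat → K) :
    powerSeries α ε u * powerSeries α ε v = powerSeries α ε fun n m =>
      ∑ k ∈ Finset.range (n + 1), u k m * v (n - k) (m + (k : ℤ) • dir α ε) := by
  refine laurentSubring_ext fun c m => ?_
  simp only [laurentSubring.coe_mul, coe_powerSeries, seriesOp_mul_apply, ← sub_smul,
    seriesOp_zsmul_dir]
  rw [finsum_eq_sum_of_support_subset (s := Finset.range (c + 1).toNat)]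
  · split_ifs with hc
    · rw [Int.toNat_add hc zero_le_one]
      refine Finset.sum_congr rfl fun k hk => ?_
      rw [if_pos (by have := Finset.mem_range.1 hk; lia), Int.toNat_sub']
    · rw [Int.toNat_of_nonpos (by lia), Finset.sum_range_zero]
  · intro k hk
    by_contra hkc
    rw [Finset.coe_range, Set.mem_Iio] at hkc
    exact hk (mul_eq_zero_of_right _ (if_neg (by lia)))

/-- The coefficients of the inverse of `∑_k u_k(m) Λ^{kσ}`. -/
def invCoeff (σ : ZLat) (u : ℕ → ZLat → K) : ℕ → ZLat → K
  | 0 => fun m => (u 0 m)⁻¹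
  | n + 1 => fun m => -(u 0 m)⁻¹ *
      ∑ k : Fin (n + 1), u (k + 1) m * invCoeff σ u (n - k) (m + ((k + 1 : ℕ) : ℤ) • σ)

theorem powerSeries_mul_powerSeries_invCoeff {u : ℕ → ZLat → K} (hu : ∀ m, u 0 m ≠ 0) :
    powerSeries α ε u * powerSeries α ε (invCoeff (dir α ε) u) = 1 := by
  rw [powerSeries_mul_powerSeries]
  refine laurentSubring_ext fun c m => ?_
  have h_iff : c • dir α ε = 0 ↔ c = 0 :=
    (zsmul_dir_injective (α := α) (ε := ε)).eq_iff' (zero_smul ℤ _)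
  have h_one : ((1 : laurentSubring K α ε) : FOp K) (c • dir α ε) m = if c = 0 then 1 else 0 :=
    if_congr h_iff rfl rfl
  rw [coe_powerSeries, seriesOp_zsmul_dir, h_one]
  rcases c with (_ | n) | n
  · simp [invCoeff, hu]
  · simp only [Int.ofNat_eq_natCast, Int.natCast_nonneg, Int.toNat_natCast, if_true]
    rw [Finset.sum_range_succ', Finset.sum_range, Nat.cast_zero, zero_smul, add_zero,
      if_neg (by lia)]
    simp only [Nat.add_sub_add_right, Nat.sub_zero]
    rw [invCoeff]
    beta_reduce
    rw [neg_mul, mul_neg, mul_inv_cancel_left₀ (hu m), add_neg_cancel]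
  · rw [if_neg (by lia), if_neg (by lia)]

theorem isUnit_powerSeries {u : ℕ → ZLat → K} (hu : ∀ m, u 0 m ≠ 0) :
    IsUnit (powerSeries α ε u) := by
  have h₁ := powerSeries_mul_powerSeries_invCoeff (α := α) (ε := ε) hu
  have h₂ := powerSeries_mul_powerSeries_invCoeff (α := α) (ε := ε) (u := invCoeff (dir α ε) u)
    fun m => by rw [invCoeff]; exact inv_ne_zero (hu m)
  exact isUnit_iff_exists.2 ⟨_, h₁, (left_inv_eq_right_inv h₁ h₂).symm ▸ h₂⟩

variable (K α ε) in
/-- The monomials `Λ_α^{-εc}` as units of `𝓔_(α)^{0,ε}`. -/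
def laurentMonomial : Multiplicative ℤ →* (laurentSubring K α ε)ˣ :=
  MonoidHom.toHomUnits
    { toFun c := ⟨monomial K α ε (.ofAdd (c.toAdd • dir α ε)), mem_laurentSubring_iff.2
        (shift_mem_supportedIn (zsmul_dir_mem_axis c.toAdd))⟩
      map_one' := Subtype.ext (by simp)
      map_mul' c d := Subtype.ext (by simp [add_smul]) }

theorem coe_laurentMonomial (c : ℤ) :
    ((laurentMonomial K α ε (.ofAdd c) : laurentSubring K α ε) : FOp K) =
      shift (c • dir α ε) := rfl

theorem isUnit_of_leadingCoeff_ne_zero (c : ℤ) {P : laurentSubring K α ε}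
    (h_lt : ∀ d < c, ∀ m, (P : FOp K) (d • dir α ε) m = 0)
    (h_lead : ∀ m, (P : FOp K) (c • dir α ε) m ≠ 0) : IsUnit P := by
  have hP : P = powerSeries α ε (fun k m => (P : FOp K) ((k + c) • dir α ε) m) *
      laurentMonomial K α ε (.ofAdd c) := by
    refine laurentSubring_ext fun d m => ?_
    rw [laurentSubring.coe_mul, coe_powerSeries, coe_laurentMonomial, mul_shift_apply,
      ← sub_smul, seriesOp_zsmul_dir]
    split_ifs with hd
    · rw [Int.toNat_of_nonneg hd, sub_add_cancel]
    · exact h_lt d (by lia) m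
  rw [hP]
  exact (isUnit_powerSeries fun m => by simpa using h_lead m).mul (Units.isUnit _)

end LaurentSeries

section WaveKernels

variable {K : Type} [Field K] {α : Fin 2} {ε : ℤˣ} {w : ZLat}

/-! ### The operator `Λ₁ Δ₂ + ρ` -/

variable (α ε) in
/-- The functions of `m` as elements of `𝓔_(α)^{0,ε}`. -/
def laurentScalar (f : ZLat → K) : laurentSubring K α ε :=
  ⟨⟨scalar f, scalar_mem_OpRing f⟩,
    mem_laurentSubring_iff.2 (scalar_mem_supportedIn (show (0 : ZLat) ∈ axis α from rfl) f)⟩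

theorem laurentScalar_apply (f : ZLat → K) (c : ℤ) (m : ZLat) :
    (laurentScalar α ε f : FOp K) (c • dir α ε) m = if c = 0 then f m else 0 :=
  if_congr (zsmul_dir_injective.eq_iff' (zero_smul ℤ _)) rfl rfl

theorem laurentMonomial_apply (d c : ℤ) (m : ZLat) :
    ((laurentMonomial K α ε (.ofAdd d) : laurentSubring K α ε) : FOp K) (c • dir α ε) m =
      if c = d then 1 else 0 :=
  if_congr zsmul_dir_injective.eq_iff rfl rfl

theorem isUnit_laurentScalar {f : ZLat → K} (hf : ∀ m, f m ≠ 0) :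
    IsUnit (laurentScalar α ε f) := by
  refine isUnit_of_leadingCoeff_ne_zero 0 (fun d hd m => ?_) fun m => ?_
  · rw [laurentScalar_apply, if_neg hd.ne]
  · rw [laurentScalar_apply, if_pos rfl]
    exact hf m

theorem isUnit_laurentMonomial_sub_laurentScalar {d : ℤ} (hd : d ≠ 0) {f : ZLat → K}
    (hf : ∀ m, f m ≠ 0) :
    IsUnit ((laurentMonomial K α ε (.ofAdd d) : laurentSubring K α ε) - laurentScalar α ε f) := by
  have h_apply (c : ℤ) (m : ZLat) :
      (((laurentMonomial K α ε (.ofAdd d) : laurentSubring K α ε) - laurentScalar α ε f :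
        laurentSubring K α ε) : FOp K) (c • dir α ε) m =
        (if c = d then 1 else 0) - if c = 0 then f m else 0 :=
    congrArg₂ (· - ·) (laurentMonomial_apply d c m) (laurentScalar_apply f c m)
  refine isUnit_of_leadingCoeff_ne_zero (min d 0) (fun c hc m => ?_) fun m => ?_
  · rw [h_apply, if_neg (by lia), if_neg (by lia), sub_zero]
  · rw [h_apply]
    rcases hd.lt_or_gt with hd | hd
    · rw [min_eq_left hd.le, if_pos rfl, if_neg hd.ne, sub_zero]
      exact one_ne_zero
    · rw [min_eq_right hd.le, if_neg hd.ne, if_pos rfl, zero_sub]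
      exact neg_ne_zero.2 (hf m)

theorem neg_unit_zsmul_dir (α : Fin 2) (ε : ℤˣ) : (-(ε : ℤ)) • dir α ε = Pi.single α 1 := by
  rw [dir, ← Pi.single_smul, smul_eq_mul, neg_mul_neg, Int.units_coe_mul_self]

/-- The operator `Λ₁ Δ₂ + ρ`. -/
def hop (ρ : ZLat → K) : FOp K := shift e₁ * (shift e₂ - 1) + scalar ρ

variable (α ε) in
/-- `hop ρ` as an element of `𝓔_(α)^ε`. -/
def hopRing (ρ : ZLat → K) : OpRing K α ε :=
  (monomial K α ε (.ofAdd e₁) : OpRing K α ε) * ((monomial K α ε (.ofAdd e₂) : OpRing K α ε) - 1) +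
    laurentScalar α ε ρ

theorem coe_hopRing (ρ : ZLat → K) : (hopRing α ε ρ : FOp K) = hop ρ := rfl

theorem coe_laurentMonomial_neg_unit :
    ((laurentMonomial K α ε (.ofAdd (-ε)) : laurentSubring K α ε) : OpRing K α ε) =
      monomial K α ε (.ofAdd (Pi.single α 1)) := by
  rw [← neg_unit_zsmul_dir α ε]
  rfl

theorem exists_hopRing_eq {ρ : ZLat → K} (hρ : ∀ m, ρ m ≠ 0) :
    ∃ x y : (laurentSubring K α ε)ˣ,
      hopRing α ε ρ = ((x : laurentSubring K α ε) : OpRing K α ε) * otherShift K α ε -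
        (y : laurentSubring K α ε) := by
  have hε : -(ε : ℤ) ≠ 0 := neg_ne_zero.2 ε.ne_zero
  match α with
  | 0 =>
    obtain ⟨y, hy⟩ := isUnit_laurentMonomial_sub_laurentScalar (α := 0) (ε := ε) hε hρ
    refine ⟨laurentMonomial K 0 ε (.ofAdd (-ε)), y, ?_⟩
    rw [hy, AddSubgroupClass.coe_sub, coe_laurentMonomial_neg_unit, hopRing, mul_sub, mul_one,
      sub_sub_eq_add_sub, add_sub_right_comm]
    rfl
  | 1 =>
    obtain ⟨x, hx⟩ := isUnit_laurentMonomial_sub_laurentScalar (α := 1) (ε := ε) hε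
      (f := (1 : ZLat → K)) fun _ => one_ne_zero
    obtain ⟨y, hy⟩ := (isUnit_laurentScalar (α := 1) (ε := ε) hρ).neg
    have h_comm : (monomial K 1 ε (.ofAdd e₁) : OpRing K 1 ε) * monomial K 1 ε (.ofAdd e₂) =
        monomial K 1 ε (.ofAdd e₂) * monomial K 1 ε (.ofAdd e₁) :=
      ((Commute.all (.ofAdd e₁ : Multiplicative ZLat) (.ofAdd e₂)).map (monomial K 1 ε)).units_val
    refine ⟨x, y, ?_⟩
    rw [hx, hy, AddSubgroupClass.coe_sub, coe_laurentMonomial_neg_unit, NegMemClass.coe_neg,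
      sub_neg_eq_add, hopRing, mul_sub, mul_one, h_comm, sub_mul]
    congr 2
    exact (one_mul _).symm

/-! ### Wave kernels -/

/-- The coefficient of `z^N` in `(∑_p f_p z^p) (∑_q g_q z^q)`. -/
def convol {R : Type*} [Semiring R] (f g : ℕ → R) (N : ℤ) : R :=
  if 0 ≤ N then ∑ x ∈ Finset.HasAntidiagonal.antidiagonal N.toNat, f x.1 * g x.2 else 0

/-- The series `∑_j v_N(m + e₁ + j) Λ^j` with `N = c + w ⬝ᵥ j`. -/
def dualKernel (w : ZLat) (c : ℤ) (v : ℕ → ZLat → K) : SeriesModule K w :=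
  ⟨fun j m => if 0 ≤ c + w ⬝ᵥ j then v (c + w ⬝ᵥ j).toNat (m + e₁ + j) else 0,
    -c, fun _ hj => funext fun _ => if_neg fun h => hj (neg_le_iff_add_nonneg'.2 h)⟩

/-- The series `∑_j (∑_{p + q = N} u_p(m) v_q(m + e₁ + j)) Λ^j` with `N = c + w ⬝ᵥ j`. Its
coefficients are those of a product of two wave functions at equal times. -/
def waveKernel (w : ZLat) (c : ℤ) (u v : ℕ → ZLat → K) : SeriesModule K w :=
  ⟨fun j m => convol (fun p => u p m) (fun q => v q (m + e₁ + j)) (c + w ⬝ᵥ j),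
    -c, fun _ hj => funext fun _ => if_neg fun h => hj (neg_le_iff_add_nonneg'.2 h)⟩

theorem dualKernel_apply (c : ℤ) (v : ℕ → ZLat → K) (j m : ZLat) :
    (dualKernel w c v : FOp K) j m =
      if 0 ≤ c + w ⬝ᵥ j then v (c + w ⬝ᵥ j).toNat (m + e₁ + j) else 0 := rfl

theorem waveKernel_apply (c : ℤ) (u v : ℕ → ZLat → K) (j m : ZLat) :
    (waveKernel w c u v : FOp K) j m =
      convol (fun p => u p m) (fun q => v q (m + e₁ + j)) (c + w ⬝ᵥ j) := rfl

theorem waveKernel_apply_of_neg {c : ℤ} (u v : ℕ → ZLat → K) {j : ZLat} (m : ZLat)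
    (h : c + w ⬝ᵥ j < 0) : (waveKernel w c u v : FOp K) j m = 0 :=
  if_neg h.not_ge

theorem waveKernel_apply_of_eq_zero {c : ℤ} (u v : ℕ → ZLat → K) {j : ZLat} (m : ZLat)
    (h : c + w ⬝ᵥ j = 0) : (waveKernel w c u v : FOp K) j m = u 0 m * v 0 (m + e₁ + j) := by
  rw [waveKernel_apply, h]
  simp [convol]

theorem dotProduct_dir (hw : w α = -ε) (c : ℤ) : w ⬝ᵥ (c • dir α ε) = c := by
  rw [dotProduct_eq (α := α), zsmul_dir_mem_axis c, mul_zero, add_zero, hw, zsmul_dir_self,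
    neg_mul_neg, unit_mul_unit_mul]

section Action

variable [hw : Fact (w α = -ε)]

theorem powerSeries_smul_dualKernel (c : ℤ) (u v : ℕ → ZLat → K) :
    powerSeries α ε u • dualKernel w c v = waveKernel w c u v := by
  refine Subtype.ext (FOp.ext fun j m => ?_)
  change (seriesOp α ε u * (dualKernel w c v : FOp K)) j m = _
  have h_add (k : ℤ) : m + k • dir α ε + e₁ + (j - k • dir α ε) = m + e₁ + j := by abel
  simp only [seriesOp_mul_apply, dualKernel_apply, waveKernel_apply, h_add, dotProduct_sub,
    dotProduct_dir hw.1, ← add_sub_assoc]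
  generalize c + w ⬝ᵥ j = N
  rw [finsum_eq_sum_of_support_subset (s := Finset.range (N + 1).toNat)]
  · rw [convol]
    split_ifs with hN
    · rw [Finset.Nat.sum_antidiagonal_eq_sum_range_succ (fun p q => u p m * v q (m + e₁ + j)),
        Int.toNat_add hN zero_le_one]
      refine Finset.sum_congr rfl fun k hk => ?_
      rw [if_pos (by have := Finset.mem_range.1 hk; lia), Int.toNat_sub']
    · rw [Int.toNat_of_nonpos (by lia), Finset.sum_range_zero]
  · intro k hk
    by_contra hkN
    rw [Finset.coe_range, Set.mem_Iio] at hkN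
    exact hk (mul_eq_zero_of_right _ (if_neg (by lia)))

theorem monomial_smul_dualKernel (i : ZLat) (c : ℤ) (v : ℕ → ZLat → K) :
    monomial K α ε (.ofAdd i) • dualKernel w c v = dualKernel w (c - w ⬝ᵥ i) v := by
  refine Subtype.ext (FOp.ext fun j m => ?_)
  refine (shift_mul_apply i (dualKernel w c v : FOp K) j m).trans ?_
  rw [dualKernel_apply, dualKernel_apply, dotProduct_sub, add_sub_left_comm, add_comm (w ⬝ᵥ j),
    show m + i + e₁ + (j - i) = m + e₁ + j by abel]

theorem isUnit_rowMap_dualKernel (c : ℤ) {v : ℕ → ZLat → K} (hv : ∀ m, v 0 m ≠ 0) :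
    IsUnit (rowMap α ε (dualKernel w c v)) := by
  have h_apply (d : ℤ) (m : ZLat) : (rowMap α ε (dualKernel w c v) : FOp K) (d • dir α ε) m =
      if 0 ≤ c + d then v (c + d).toNat (m + e₁ + d • dir α ε) else 0 := by
    refine (if_pos (zsmul_dir_mem_axis d)).trans ?_
    rw [dualKernel_apply, dotProduct_dir hw.1]
  refine isUnit_of_leadingCoeff_ne_zero (-c) (fun d hd m => ?_) fun m => ?_
  · rw [h_apply, if_neg (by lia)]
  · rw [h_apply, add_neg_cancel, if_pos le_rfl]
    exact hv _

theorem isUnit_rowMap_waveKernel (c : ℤ) {u v : ℕ → ZLat → K} (hu : ∀ m, u 0 m ≠ 0)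
    (hv : ∀ m, v 0 m ≠ 0) : IsUnit (rowMap α ε (waveKernel w c u v)) := by
  rw [← powerSeries_smul_dualKernel (α := α) (ε := ε), map_smul]
  exact (isUnit_powerSeries hu).mul (isUnit_rowMap_dualKernel c hv)

theorem smul_waveKernel_eq_zero (hw' : w (1 - α) = 0) {c : ℤ} {u v : ℕ → ZLat → K}
    (hv : ∀ m, v 0 m ≠ 0) {C : OpRing K α ε} (h : rowMap α ε (C • waveKernel w c u v) = 0) :
    C • waveKernel w c u v = 0 := by
  have h_smul : C • waveKernel w c u v =
      (C * (powerSeries α ε u : OpRing K α ε)) • dualKernel w c v := by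
    rw [mul_smul, ← powerSeries_smul_dualKernel (α := α) (ε := ε)]
    rfl
  rw [h_smul] at h ⊢
  refine smul_eq_zero_of_rowMap_eq_zero ?_ (isUnit_rowMap_dualKernel c hv) _ h
  rw [otherShift, monomial_smul_dualKernel, dotProduct_single, hw', zero_mul, sub_zero]

end Action

/-! ### Lax operators -/

theorem invIn_coe_unit (P : (laurentSubring K α ε)ˣ) :
    invIn (opEα0 K α ε) ((P : laurentSubring K α ε) : FOp K) =
      ((P⁻¹ : (laurentSubring K α ε)ˣ) : laurentSubring K α ε) := by
  have h_ex : ∃ T ∈ opEα0 K α ε, ((P : laurentSubring K α ε) : FOp K) * T = 1 ∧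
      T * ((P : laurentSubring K α ε) : FOp K) = 1 :=
    ⟨_, mem_opEα0_iff.2 ⟨(P⁻¹ : (laurentSubring K α ε)ˣ), rfl⟩,
      congrArg (fun Q : laurentSubring K α ε => (Q : FOp K)) P.mul_inv,
      congrArg (fun Q : laurentSubring K α ε => (Q : FOp K)) P.inv_mul⟩
  rw [invIn, dif_pos h_ex]
  obtain ⟨hT, -, hTP⟩ := h_ex.choose_spec
  obtain ⟨Q, hQ⟩ := mem_opEα0_iff.1 hT
  rw [← hQ] at hTP ⊢
  have hQP : Q * P = 1 := Subtype.ext (Subtype.ext hTP)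
  rw [left_inv_eq_right_inv hQP P.mul_inv]

variable (α ε) in
/-- The Lax operator `S Λ_α^ε S⁻¹` of `S = ∑_k u_k(m) Λ_α^{-εk}`. -/
def laxSeries (u : ℕ → ZLat → K) : laurentSubring K α ε :=
  powerSeries α ε u * laurentMonomial K α ε (.ofAdd (-1)) * Ring.inverse (powerSeries α ε u)

theorem coe_laxSeries {u : ℕ → ZLat → K} (hu : ∀ m, u 0 m ≠ 0) :
    (laxSeries α ε u : FOp K) =
      seriesOp α ε u * shift (-dir α ε) * invIn (opEα0 K α ε) (seriesOp α ε u) := by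
  obtain ⟨S, hS⟩ := isUnit_powerSeries (α := α) (ε := ε) hu
  rw [laxSeries, ← coe_powerSeries, ← hS, Ring.inverse_unit, invIn_coe_unit,
    ← neg_one_zsmul (dir α ε)]
  rfl

theorem laxSeries_pow_smul_waveKernel [hw : Fact (w α = -ε)] {u : ℕ → ZLat → K}
    (hu : ∀ m, u 0 m ≠ 0) (n : ℕ) (c : ℤ) (v : ℕ → ZLat → K) :
    laxSeries α ε u ^ n • waveKernel w c u v = waveKernel w (c + n) u v := by
  have h_step (c : ℤ) : laxSeries α ε u • waveKernel w c u v = waveKernel w (c + 1) u v := by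
    have h_shift : (laurentMonomial K α ε (.ofAdd (-1)) : laurentSubring K α ε) •
        dualKernel w c v = dualKernel w (c + 1) v := by
      refine (monomial_smul_dualKernel ((-1 : ℤ) • dir α ε) c v).trans ?_
      rw [dotProduct_dir hw.1, sub_neg_eq_add]
    rw [← powerSeries_smul_dualKernel (α := α) (ε := ε), laxSeries, ← mul_smul,
      Ring.inverse_mul_cancel_right _ _ (isUnit_powerSeries hu), mul_smul, h_shift,
      powerSeries_smul_dualKernel]
  induction n generalizing c with
  | zero => rw [pow_zero, one_smul, Nat.cast_zero, add_zero]
  | succ n ih => rw [pow_succ, mul_smul, h_step, ih, Nat.cast_succ, add_assoc, add_comm 1]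

end WaveKernels

section DeltaExpansion

variable {K : Type} [Field K] {ε : ℤˣ}

/-! ### The part of positive order in `Δ₂` or `Δ₂^*` -/

theorem pow_succ_sub_one_eq_sum_choose {R : Type*} [Ring R] (x : R) {k N : ℕ} (hk : k < N) :
    x ^ (k + 1) - 1 = ∑ i ∈ Finset.range N, (k + 1).choose (i + 1) • (x - 1) ^ (i + 1) := by
  have h_binomial : x ^ (k + 1) =
      ∑ i ∈ Finset.range (N + 1), (k + 1).choose i • (x - 1) ^ i := by
    conv_lhs => rw [← sub_add_cancel x 1, (Commute.one_right (x - 1)).add_pow]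
    simp only [one_pow, mul_one, nsmul_eq_mul']
    refine Finset.sum_subset (Finset.range_mono (by lia)) fun i _ hi => ?_
    rw [Nat.choose_eq_zero_of_lt (by simpa using hi), Nat.cast_zero, mul_zero]
  rw [h_binomial, Finset.sum_range_succ', Nat.choose_zero_right, pow_zero, one_nsmul,
    add_sub_cancel_right]

theorem finsum_choose_mul_eq_sum {a : ℕ → K} {N : ℕ} (ha : ∀ k, N < k → a k = 0) (i : ℕ) :
    ∑ᶠ l : ℕ, ((i + 1 + l).choose l : K) * a (i + 1 + l) =
      ∑ k ∈ Finset.range N, ((k + 1).choose (i + 1) : K) * a (k + 1) := by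
  rw [finsum_eq_sum_of_support_subset (s := Finset.range N)]
  · have h_extend : ∑ k ∈ Finset.range N, ((k + 1).choose (i + 1) : K) * a (k + 1) =
        ∑ k ∈ Finset.range (i + N), ((k + 1).choose (i + 1) : K) * a (k + 1) := by
      refine Finset.sum_subset (Finset.range_mono (by lia)) fun k _ hk => ?_
      rw [ha (k + 1) (by simpa [Nat.lt_succ_iff] using hk), mul_zero]
    have h_low : ∑ k ∈ Finset.range i, ((k + 1).choose (i + 1) : K) * a (k + 1) = 0 := by
      refine Finset.sum_eq_zero fun k hk => ?_
      rw [Nat.choose_eq_zero_of_lt (by simpa using hk), Nat.cast_zero, zero_mul]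
    rw [h_extend, Finset.sum_range_add, h_low, zero_add]
    refine Finset.sum_congr rfl fun l _ => ?_
    rw [add_right_comm i l 1, Nat.choose_symm_add]
  · intro l hl
    by_contra hlN
    exact hl (mul_eq_zero_of_right _ (ha _ (by simp at hlN; lia)))

theorem shift_sub_one_apply_eq_sum_choose (ε : ℤˣ) {k N : ℕ} (hk : k < N) (j m : ZLat) :
    (shift (Pi.single 1 (ε * ((k + 1 : ℕ) : ℤ))) - 1 : FOp K) j m =
      ∑ i ∈ Finset.range N, ((k + 1).choose (i + 1) : K) *
        ((shift (Pi.single 1 (ε : ℤ)) - 1 : FOp K) ^ (i + 1)) j m := by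
  set x : OpRing K 1 1 := (monomial K 1 1 (.ofAdd (Pi.single 1 (ε : ℤ))) : OpRing K 1 1)
  have h_pow : ((x ^ (k + 1) : OpRing K 1 1) : FOp K) =
      shift (Pi.single 1 (ε * ((k + 1 : ℕ) : ℤ))) := by
    rw [← Units.val_pow_eq_pow_val, ← map_pow, ← ofAdd_nsmul, ← Pi.single_smul, nsmul_eq_mul,
      mul_comm]
    rfl
  have h_sum := congrArg (fun A : OpRing K 1 1 => (A : FOp K) j m)
    (pow_succ_sub_one_eq_sum_choose x hk)
  simp only [AddSubgroupClass.coe_sub, h_pow, AddSubmonoidClass.coe_finsetSum, FOp.sum_apply,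
    AddSubmonoidClass.coe_nsmul, OpRing.coe_pow] at h_sum
  refine h_sum.trans (Finset.sum_congr rfl fun i _ => ?_)
  exact nsmul_eq_mul _ _

/-- Writing `A = ∑_k a_k (D + 1)^k`, the part of positive order in `D` of `(D + 1)^k` is
`(D + 1)^k - 1` for `k ≥ 1`, and it vanishes for `k ≤ 0`. -/
theorem deltaPosPart_eq_sum {A : FOp K} {N : ℕ}
    (hN : ∀ k : ℕ, N < k → A (Pi.single 1 (ε * (k : ℤ))) = 0) :
    deltaPosPart ε A = ∑ k ∈ Finset.range N, scalar (A (Pi.single 1 (ε * ((k + 1 : ℕ) : ℤ)))) *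
      (shift (Pi.single 1 (ε * ((k + 1 : ℕ) : ℤ))) - 1) := by
  have h_coeff (i : ℕ) (m : ZLat) := finsum_choose_mul_eq_sum
    (a := fun k => A (Pi.single 1 (ε * (k : ℤ))) m) (fun k hk => congrFun (hN k hk) m) i
  unfold deltaPosPart
  simp only [h_coeff]
  rw [finsum_eq_sum_of_support_subset (s := Finset.range N)]
  · refine FOp.ext fun j m => ?_
    simp only [FOp.sum_apply, scalar_mul_apply, Finset.sum_mul]
    rw [Finset.sum_comm]
    refine Finset.sum_congr rfl fun k hk => ?_
    rw [shift_sub_one_apply_eq_sum_choose ε (Finset.mem_range.1 hk), Finset.mul_sum]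
    refine Finset.sum_congr rfl fun i _ => ?_
    ring
  · intro i hi
    by_contra hiN
    refine hi (FOp.ext fun j m => ?_)
    refine (scalar_mul_apply _ _ j m).trans (mul_eq_zero_of_left ?_ _)
    refine Finset.sum_eq_zero fun k hk => ?_
    rw [Nat.choose_eq_zero_of_lt (by simp at hiN hk; lia), Nat.cast_zero, zero_mul]

theorem single_mem_axis (c : ℤ) : (Pi.single 1 c : ZLat) ∈ axis 1 := rfl

theorem scalar_mul_shift_sub_one_apply (f : ZLat → K) (i j m : ZLat) :
    (scalar f * (shift i - 1) : FOp K) j m =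
      f m * ((shift i : FOp K) j m - (shift 0 : FOp K) j m) := by
  rw [scalar_mul_apply, FOp.sub_apply, shift_zero]

theorem hasFiniteSupport_shift (i m : ZLat) :
    Function.HasFiniteSupport fun j => (shift i : FOp K) j m :=
  (Set.finite_singleton i).subset fun j hj => by simpa [shift_apply] using hj

theorem finsum_shift (i m : ZLat) : ∑ᶠ j, (shift i : FOp K) j m = 1 :=
  (finsum_eq_single _ i fun _ hj => if_neg hj).trans (if_pos rfl)

theorem hasFiniteSupport_scalar_mul_shift_sub_one (f : ZLat → K) (i m : ZLat) :
    Function.HasFiniteSupport fun j => (scalar f * (shift i - 1) : FOp K) j m := by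
  simp only [scalar_mul_shift_sub_one_apply]
  exact ((hasFiniteSupport_shift i m).sub (hasFiniteSupport_shift 0 m)).subset
    (Function.support_mul_subset_right _ _)

theorem finsum_scalar_mul_shift_sub_one (f : ZLat → K) (i m : ZLat) :
    ∑ᶠ j, (scalar f * (shift i - 1) : FOp K) j m = 0 := by
  simp only [scalar_mul_shift_sub_one_apply]
  rw [← mul_finsum, finsum_sub_distrib (hasFiniteSupport_shift i m) (hasFiniteSupport_shift 0 m),
    finsum_shift, finsum_shift, sub_self, mul_zero]

section DeltaPosPart

variable {A : FOp K} (hA : A ∈ opEα0 K 1 ε)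

include hA

theorem exists_bound_of_mem_opEα0 :
    ∃ N : ℕ, ∀ k : ℕ, N < k → A (Pi.single 1 (ε * (k : ℤ))) = 0 := by
  obtain ⟨N, hN⟩ := mem_opEα_iff.1 hA.1
  refine ⟨N.toNat, fun k hk => hN _ fun h => ?_⟩
  have h_le := h.1
  rw [Pi.single_eq_same, unit_mul_unit_mul] at h_le
  lia

theorem exists_deltaPosPart_mem_supportedIn :
    ∃ N : ℕ, deltaPosPart ε A ∈ supportedIn K {j | j 0 = 0 ∧ 0 ≤ ε * j 1 ∧ ε * j 1 ≤ N} := by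
  obtain ⟨N, hN⟩ := exists_bound_of_mem_opEα0 hA
  refine ⟨N, deltaPosPart_eq_sum hN ▸ sum_mem fun k hk => ?_⟩
  have h_mem (c : ℕ) (hc : c ≤ N) :
      (Pi.single 1 (ε * (c : ℤ)) : ZLat) ∈ {j : ZLat | j 0 = 0 ∧ 0 ≤ ε * j 1 ∧ ε * j 1 ≤ N} := by
    refine ⟨single_mem_axis _, ?_⟩
    rw [Pi.single_eq_same, unit_mul_unit_mul]
    exact ⟨Int.natCast_nonneg c, Int.ofNat_le.2 hc⟩
  refine mul_mem_supportedIn (s := {0}) (scalar_mem_supportedIn (Set.mem_singleton 0) _)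
    (sub_mem (shift_mem_supportedIn (h_mem (k + 1) (Finset.mem_range.1 hk)))
      (scalar_mem_supportedIn (by simp) 1)) fun i hi j hj => ?_
  rwa [Set.mem_singleton_iff.1 hi, zero_add]

theorem deltaPosPart_mem_supportedIn :
    deltaPosPart ε A ∈ supportedIn K {j | j 0 = 0 ∧ 0 ≤ ε * j 1} :=
  (exists_deltaPosPart_mem_supportedIn hA).elim fun _ h =>
    supportedIn_mono (fun _ hj => And.intro hj.1 hj.2.1) h

theorem deltaPosPart_mem_opE : deltaPosPart ε A ∈ opE K := by
  obtain ⟨N, hN⟩ := exists_deltaPosPart_mem_supportedIn hA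
  refine (finite_setOf_abs_le 1 N).subset fun j hj => ?_
  obtain ⟨hj₀, hj₁, hjN⟩ := mem_supportedIn_iff.1 hN j hj
  have h_abs : |j 1| ≤ N := by
    rwa [← one_mul |j 1|, ← Int.isUnit_iff_abs_eq.1 ε.isUnit, ← abs_mul, abs_of_nonneg hj₁]
  exact ⟨h_abs, (abs_eq_zero.2 hj₀).trans_le (Int.natCast_nonneg N)⟩

theorem sub_deltaPosPart_mem_supportedIn :
    A - deltaPosPart ε A ∈ supportedIn K {j | j 0 = 0 ∧ ε * j 1 ≤ 0} := by
  intro j hj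
  by_cases hj₀ : j 0 = 0
  · obtain ⟨N, hN⟩ := exists_bound_of_mem_opEα0 hA
    have hj₁ : 0 < ε * j 1 := not_le.1 fun h => hj ⟨hj₀, h⟩
    obtain ⟨k, hk⟩ := Int.eq_succ_of_zero_lt hj₁
    obtain rfl : j = Pi.single 1 (ε * ((k + 1 : ℕ) : ℤ)) := by
      rw [Nat.cast_succ, ← hk, unit_mul_unit_mul]
      exact funext (Fin.forall_fin_two.2 ⟨hj₀, rfl⟩)
    have h_single (i : ℕ) (m : ZLat) : (shift (Pi.single 1 (ε * ((i + 1 : ℕ) : ℤ))) - 1 : FOp K)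
        (Pi.single 1 (ε * ((k + 1 : ℕ) : ℤ))) m = if k = i then 1 else 0 := by
      have h_inj : Function.Injective fun c : ℕ => (Pi.single 1 (ε * (c : ℤ)) : ZLat) :=
        (Pi.single_injective _).comp
          ((mul_right_injective₀ ε.isUnit.ne_zero).comp Nat.cast_injective)
      have h_zero : (Pi.single 1 (ε * ((k + 1 : ℕ) : ℤ)) : ZLat) ≠ 0 := by
        simpa using h_inj.ne k.succ_ne_zero
      rw [FOp.sub_apply, ← shift_zero, shift_apply, shift_apply, if_neg h_zero, sub_zero]
      exact if_congr (h_inj.eq_iff.trans Nat.succ_inj) rfl rfl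
    refine funext fun m => sub_eq_zero.2 ?_
    rw [deltaPosPart_eq_sum hN, FOp.sum_apply]
    simp only [scalar_mul_apply, h_single, mul_ite, mul_one, mul_zero, Finset.sum_ite_eq]
    split_ifs with hkN
    · rfl
    · rw [hN (k + 1) (by simpa [Nat.lt_succ_iff] using hkN), Pi.zero_apply]
  · have h_part : deltaPosPart ε A j = 0 := deltaPosPart_mem_supportedIn hA j fun h => hj₀ h.1
    have h_op : A j = 0 := hA.2 j ⟨0, zero_ne_one, hj₀⟩
    exact (congrArg₂ (· - ·) h_op h_part).trans (sub_zero 0)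

theorem finsum_deltaPosPart (m : ZLat) : ∑ᶠ j, deltaPosPart ε A j m = 0 := by
  obtain ⟨N, hN⟩ := exists_bound_of_mem_opEα0 hA
  rw [deltaPosPart_eq_sum hN]
  simp only [FOp.sum_apply]
  rw [finsum_sum_comm _ _ fun k _ => hasFiniteSupport_scalar_mul_shift_sub_one _ _ m]
  exact Finset.sum_eq_zero fun k _ => finsum_scalar_mul_shift_sub_one _ _ m

end DeltaPosPart

end DeltaExpansion

section WaveData

variable {K : Type} [Field K] {ε : ℤˣ} {w : ZLat}

/-! ### Wave data -/

theorem opE_subset_OpRing (α : Fin 2) (ε : ℤˣ) : opE K ⊆ OpRing K α ε := fun A hA => by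
  obtain ⟨N, hN⟩ := (hA.image fun j => |j α| + |j (1 - α)|).bddAbove
  exact mem_OpRing_iff.2 ⟨N, mem_supportedIn_iff.2 fun _ hj =>
    halfStrip_mono (hN (Set.mem_image_of_mem _ hj)) (mem_halfStrip_self _)⟩

theorem composable_of_mem_opE {A : FOp K} (hA : A ∈ opE K) (C : FOp K) : Composable A C :=
  fun _ => hA.subset fun _ => And.left

theorem add_mem_opE {A B : FOp K} (hA : A ∈ opE K) (hB : B ∈ opE K) : A + B ∈ opE K :=
  (hA.union hB).subset fun _ hj => not_and_or.1 fun h0 =>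
    hj ((congrArg₂ (· + ·) h0.1 h0.2).trans (add_zero 0))

theorem mul_sub_mul_mem_supportedIn {α : Fin 2} (hw : w α = -ε) {A B C : FOp K}
    (hA : A ∈ OpRing K α ε) (hB : B ∈ OpRing K α ε) (hC : C ∈ SeriesModule K w)
    {s t r : Set ZLat} (hAB : A - B ∈ supportedIn K s) (hC' : C ∈ supportedIn K t)
    (h : ∀ i ∈ s, ∀ k ∈ t, i + k ∈ r) : A * C - B * C ∈ supportedIn K r := by
  have h_sub : A * C = (A - B) * C + B * C := by
    rw [← Composable.add_mul (composable_of_mem hw (sub_mem hA hB) hC)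
      (composable_of_mem hw hB hC), sub_add_cancel]
  rw [h_sub, add_sub_cancel_right]
  exact mul_mem_supportedIn hAB hC' h

/-- The order `weight₁ ⬝ᵥ j` of `Λ^j` on the first wave function, on which `Λ₁` and `Λ₂` act as
`z` and `1` to leading order, and which is expanded in powers of `z⁻¹`. -/
def weight₁ : ZLat := ![-1, 0]

/-- The analogue of `weight₁` for the second wave function, with leading terms `1` and `z`, and
expansion in powers of `z`. -/
def weight₂ : ZLat := ![0, 1]

/-- The analogue of `weight₁` for the third wave function, with leading terms `z` and `z⁻¹`, and
expansion in powers of `z`. -/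
def weight₃ : ZLat := ![1, -1]

theorem weight₁_dotProduct (j : ZLat) : weight₁ ⬝ᵥ j = -j 0 := by
  simp [weight₁, dotProduct, Fin.sum_univ_two]

theorem weight₂_dotProduct (j : ZLat) : weight₂ ⬝ᵥ j = j 1 := by
  simp [weight₂, dotProduct, Fin.sum_univ_two]

theorem weight₃_dotProduct (j : ZLat) : weight₃ ⬝ᵥ j = j 0 - j 1 := by
  simp [weight₃, dotProduct, Fin.sum_univ_two, sub_eq_add_neg]

instance : Fact (weight₁ 0 = -((1 : ℤˣ) : ℤ)) := ⟨rfl⟩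

instance : Fact (weight₂ 1 = -((-1 : ℤˣ) : ℤ)) := ⟨rfl⟩

instance : Fact (weight₃ 0 = -((-1 : ℤˣ) : ℤ)) := ⟨rfl⟩

instance : Fact (weight₃ 1 = -((1 : ℤˣ) : ℤ)) := ⟨rfl⟩

section Kernels

variable (u v : Fin 3 → ℕ → ZLat → K) (c : ℤ)

/-- The left hand side of the bilinear equations at equal times: its coefficient at `j` is that
for `m' = m + e₁ + j`, and `c` stands for `n₁ l`. -/
def kernel₁ : SeriesModule K weight₁ := waveKernel weight₁ c (u 0) (v 0)

/-- The first term of the right hand side of the bilinear equations at equal times, with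
`c = n₂ l`. -/
def kernel₂ : SeriesModule K weight₂ := waveKernel weight₂ (c - 1) (u 1) (v 1)

/-- The second term of the right hand side of the bilinear equations at equal times, with
`c = n₃ l`. -/
def kernel₃ : SeriesModule K weight₃ := waveKernel weight₃ c (u 2) (v 2)

theorem kernel₁_mem_supportedIn : (kernel₁ u v 0 : FOp K) ∈ supportedIn K {j | j 0 ≤ 0} :=
  fun j hj => funext fun m => waveKernel_apply_of_neg _ _ m <| by
    rw [Set.mem_ofPred_eq] at hj
    rw [weight₁_dotProduct]
    lia

theorem kernel₂_mem_supportedIn : (kernel₂ u v 0 : FOp K) ∈ supportedIn K {j | 1 ≤ j 1} :=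
  fun j hj => funext fun m => waveKernel_apply_of_neg _ _ m <| by
    rw [Set.mem_ofPred_eq] at hj
    rw [weight₂_dotProduct]
    lia

theorem kernel₃_mem_supportedIn : (kernel₃ u v 0 : FOp K) ∈ supportedIn K {j | j 1 ≤ j 0} :=
  fun j hj => funext fun m => waveKernel_apply_of_neg _ _ m <| by
    rw [Set.mem_ofPred_eq] at hj
    rw [weight₃_dotProduct]
    lia

/-- Wave coefficients `u` and dual wave coefficients `v` satisfying the bilinear equations of the
hierarchy at equal times for `l = 0` and `l = 1`. -/
structure IsWaveData (n : Fin 3 → ℕ) : Prop where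
  left_zero_zero : ∀ m, u 0 0 m = 1
  right_zero_zero : ∀ m, v 0 0 m = 1
  bilinear_zero : (kernel₁ u v 0 : FOp K) = kernel₂ u v 0 + kernel₃ u v 0
  bilinear_one : (kernel₁ u v (n 0) : FOp K) = kernel₂ u v (n 1) + kernel₃ u v (n 2)

end Kernels

namespace IsWaveData

variable {n : Fin 3 → ℕ} {u v : Fin 3 → ℕ → ZLat → K} (h : IsWaveData u v n)

include h

theorem kernel₁_apply {j : ZLat} (hj : j 0 = 0) (m : ZLat) :
    (kernel₁ u v 0 : FOp K) j m = 1 := by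
  refine (waveKernel_apply_of_eq_zero _ _ m ?_).trans ?_
  · rw [weight₁_dotProduct, hj, neg_zero, zero_add]
  · rw [h.left_zero_zero, h.right_zero_zero, one_mul]

theorem kernel₁_apply_eq_add (j m : ZLat) : (kernel₁ u v 0 : FOp K) j m =
    (kernel₂ u v 0 : FOp K) j m + (kernel₃ u v 0 : FOp K) j m :=
  congrFun (congrFun h.bilinear_zero j) m

theorem left_two_mul_right_two (m : ZLat) : u 2 0 m * v 2 0 (m + e₁) = 1 := by
  have h₂ : (kernel₂ u v 0 : FOp K) 0 m = 0 :=
    congrFun (kernel₂_mem_supportedIn u v 0 (by simp)) m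
  have h₃ : (kernel₃ u v 0 : FOp K) 0 m = u 2 0 m * v 2 0 (m + e₁ + 0) :=
    waveKernel_apply_of_eq_zero _ _ m (by simp)
  rw [← add_zero (m + e₁), ← h₃, ← zero_add ((kernel₃ u v 0 : FOp K) 0 m), ← h₂,
    ← h.kernel₁_apply_eq_add, h.kernel₁_apply rfl]

theorem left_one_mul_right_one (m : ZLat) : u 1 0 m * v 1 0 (m + e₁₂) = 1 := by
  have h₃ : (kernel₃ u v 0 : FOp K) e₂ m = 0 :=
    congrFun (kernel₃_mem_supportedIn u v e₂ (by simp [e₂])) m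
  have h₂ : (kernel₂ u v 0 : FOp K) e₂ m = u 1 0 m * v 1 0 (m + e₁ + e₂) :=
    waveKernel_apply_of_eq_zero _ _ m (by rw [weight₂_dotProduct]; rfl)
  rw [e₁₂, ← add_assoc, ← h₂, ← add_zero ((kernel₂ u v 0 : FOp K) e₂ m), ← h₃,
    ← h.kernel₁_apply_eq_add, h.kernel₁_apply rfl]

theorem left_ne_zero (i : Fin 3) (m : ZLat) : u i 0 m ≠ 0 := by
  match i with
  | 0 => exact h.left_zero_zero m ▸ one_ne_zero
  | 1 => exact left_ne_zero_of_mul_eq_one (h.left_one_mul_right_one m)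
  | 2 => exact left_ne_zero_of_mul_eq_one (h.left_two_mul_right_two m)

theorem right_ne_zero (i : Fin 3) (m : ZLat) : v i 0 m ≠ 0 := by
  match i with
  | 0 => exact h.right_zero_zero m ▸ one_ne_zero
  | 1 =>
    rw [← sub_add_cancel m e₁₂]
    exact right_ne_zero_of_mul_eq_one (h.left_one_mul_right_one _)
  | 2 =>
    rw [← sub_add_cancel m e₁]
    exact right_ne_zero_of_mul_eq_one (h.left_two_mul_right_two _)

end IsWaveData

end WaveData

section Rigidity

variable {K : Type} [Field K] {ε : ℤˣ} {w : ZLat} {u v : Fin 3 → ℕ → ZLat → K}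
  {n : Fin 3 → ℕ}

/-! ### Rigidity -/

theorem mul_waveKernel_eq_of_sub_mem {α : Fin 2} [Fact (w α = -ε)] (hw : w (1 - α) = 0) {c : ℤ}
    {u v : ℕ → ZLat → K} (hv : ∀ m, v 0 m ≠ 0) {B R : FOp K} (hB : B ∈ OpRing K α ε)
    {M : OpRing K α ε} (hM : (M : FOp K) * waveKernel w c u v = R)
    (h_row : ∀ j ∈ axis α, (B * (waveKernel w c u v : FOp K) - R) j = 0) :
    B * (waveKernel w c u v : FOp K) = R := by
  set C : OpRing K α ε := ⟨B, hB⟩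
  have h_coe : (((C - M) • waveKernel w c u v : SeriesModule K w) : FOp K) =
      B * (waveKernel w c u v : FOp K) - R := by
    rw [sub_smul, AddSubgroupClass.coe_sub, ← hM]
    rfl
  have h_row' : rowMap α ε ((C - M) • waveKernel w c u v) = 0 := by
    refine Subtype.ext (Subtype.ext (FOp.ext fun j m => ?_))
    by_cases hj : j ∈ axis α
    · exact (if_pos hj).trans (congrFun ((congrFun h_coe j).trans (h_row j hj)) m)
    · exact if_neg hj
  exact sub_eq_zero.1 (h_coe.symm.trans
    (congrArg Subtype.val (smul_waveKernel_eq_zero hw hv h_row')))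

/-- The operator `B` of `𝓔` acts on the three kernels as multiplication by `R₁`, `R₂`, `R₃`, up to
the terms that vanish in the comparison of the two sides of the bilinear equations. -/
structure IsCongruentOnKernels (u v : Fin 3 → ℕ → ZLat → K) (B R₁ R₂ R₃ : FOp K) : Prop where
  mem_opE : B ∈ opE K
  first : B * (kernel₁ u v 0 : FOp K) - R₁ ∈ supportedIn K {j | j 1 = 0 → j 0 < 0}
  second : B * (kernel₂ u v 0 : FOp K) - R₂ ∈ supportedIn K {j | 1 ≤ j 1}
  third : B * (kernel₃ u v 0 : FOp K) - R₃ ∈ supportedIn K {j | j 1 ≤ j 0}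

namespace IsCongruentOnKernels

variable {B R₁ R₂ R₃ : FOp K}

theorem add (h : IsCongruentOnKernels u v B R₁ R₂ R₃) {B' R₁' R₂' R₃' : FOp K}
    (h' : IsCongruentOnKernels u v B' R₁' R₂' R₃') :
    IsCongruentOnKernels u v (B + B') (R₁ + R₁') (R₂ + R₂') (R₃ + R₃') := by
  have h_add (C : FOp K) : (B + B') * C = B * C + B' * C :=
    Composable.add_mul (composable_of_mem_opE h.mem_opE C) (composable_of_mem_opE h'.mem_opE C)
  refine ⟨add_mem_opE h.mem_opE h'.mem_opE, ?_, ?_, ?_⟩ <;> rw [h_add, add_sub_add_comm]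
  exacts [add_mem h.first h'.first, add_mem h.second h'.second, add_mem h.third h'.third]

variable (hB : IsCongruentOnKernels u v B R₁ R₂ R₃) (h : IsWaveData u v n) (hR : R₁ = R₂ + R₃)

include hB h hR

theorem sub_eq_add_sub : B * (kernel₁ u v 0 : FOp K) - R₁ =
    B * (kernel₂ u v 0 : FOp K) - R₂ + (B * (kernel₃ u v 0 : FOp K) - R₃) := by
  rw [h.bilinear_zero, Composable.mul_add (composable_of_mem_opE hB.mem_opE _)
    (composable_of_mem_opE hB.mem_opE _), hR, add_sub_add_comm]

theorem mul_kernel₁_eq {M : OpRing K 0 1} (hM : (M : FOp K) * kernel₁ u v 0 = R₁) :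
    B * (kernel₁ u v 0 : FOp K) = R₁ := by
  refine mul_waveKernel_eq_of_sub_mem rfl (h.right_ne_zero 0)
    (opE_subset_OpRing 0 1 hB.mem_opE) hM fun j hj => ?_
  by_cases hj₀ : j 0 < 0
  · change (B * (kernel₁ u v 0 : FOp K) - R₁) j = 0
    have hj₁ : j 1 = 0 := hj
    rw [hB.sub_eq_add_sub h hR]
    refine (congrArg₂ (· + ·) (hB.second j ?_) (hB.third j ?_)).trans (add_zero 0)
    all_goals
      rw [Set.mem_ofPred_eq]
      lia
  · exact hB.first j fun h_imp => hj₀ (h_imp hj)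

theorem mul_kernel₂_eq (h₁ : B * (kernel₁ u v 0 : FOp K) = R₁) {M : OpRing K 1 (-1)}
    (hM : (M : FOp K) * kernel₂ u v 0 = R₂) : B * (kernel₂ u v 0 : FOp K) = R₂ := by
  refine mul_waveKernel_eq_of_sub_mem rfl (h.right_ne_zero 1)
    (opE_subset_OpRing 1 (-1) hB.mem_opE) hM fun j hj => ?_
  by_cases hj₁ : 1 ≤ j 1
  · have hj₀ : j 0 = 0 := hj
    have h_third := hB.third j (by rw [Set.mem_ofPred_eq]; lia)
    have h_sum := congrFun (hB.sub_eq_add_sub h hR) j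
    rw [h₁, sub_self] at h_sum
    exact (add_zero _).symm.trans ((congrArg (_ + ·) h_third.symm).trans h_sum.symm)
  · exact hB.second j hj₁

theorem mul_kernel_eq {M₁ : OpRing K 0 1} (hM₁ : (M₁ : FOp K) * kernel₁ u v 0 = R₁)
    {M₂ : OpRing K 1 (-1)} (hM₂ : (M₂ : FOp K) * kernel₂ u v 0 = R₂) :
    B * (kernel₁ u v 0 : FOp K) = R₁ ∧ B * (kernel₂ u v 0 : FOp K) = R₂ ∧
      B * (kernel₃ u v 0 : FOp K) = R₃ := by
  have h₁ := hB.mul_kernel₁_eq h hR hM₁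
  have h₂ := hB.mul_kernel₂_eq h hR h₁ hM₂
  have h_sum := hB.sub_eq_add_sub h hR
  rw [h₁, h₂, sub_self, sub_self, zero_add] at h_sum
  exact ⟨h₁, h₂, sub_eq_zero.1 h_sum.symm⟩

end IsCongruentOnKernels

end Rigidity

section Congruences

variable {K : Type} [Field K] {ε : ℤˣ} {u v : Fin 3 → ℕ → ZLat → K} {n : Fin 3 → ℕ} {A : FOp K}

/-! ### The operators `H`, `𝓛` and `𝓛̃` on the kernels -/

theorem nonnegPart₁_add_negPart₁ (A : FOp K) : nonnegPart₁ A + negPart₁ A = A :=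
  FOp.ext fun j m => by
    by_cases hj : 0 ≤ j 0 <;> simp [FOp.add_apply, nonnegPart₁, negPart₁, hj]

theorem nonnegPart₁_mem_supportedIn (hA : A ∈ opEα0 K 0 ε) :
    nonnegPart₁ A ∈ supportedIn K {j | j 1 = 0 ∧ 0 ≤ j 0} := fun j hj => funext fun m => by
  rw [Set.mem_ofPred_eq, not_and_or] at hj
  rcases hj with hj | hj
  · exact (congrArg (ite _ · _) (congrFun (hA.2 j ⟨1, one_ne_zero, hj⟩) m)).trans (ite_self 0)
  · exact if_neg hj

theorem negPart₁_mem_supportedIn (hA : A ∈ opEα0 K 0 ε) :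
    negPart₁ A ∈ supportedIn K {j | j 1 = 0 ∧ j 0 < 0} := fun j hj => funext fun m => by
  rw [Set.mem_ofPred_eq, not_and_or] at hj
  rcases hj with hj | hj
  · exact (congrArg (ite _ · _) (congrFun (hA.2 j ⟨1, one_ne_zero, hj⟩) m)).trans (ite_self 0)
  · exact if_neg hj

theorem nonnegPart₁_mem_opE (hA : A ∈ opEα0 K 0 1) : nonnegPart₁ A ∈ opE K := by
  obtain ⟨N, hN⟩ := mem_opEα_iff.1 hA.1
  refine (finite_setOf_abs_le 0 N).subset fun j hj => ?_
  obtain ⟨-, hj₀⟩ := mem_supportedIn_iff.1 (nonnegPart₁_mem_supportedIn hA) j hj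
  have hAj : A j ≠ 0 := fun h0 => hj <| funext fun m =>
    (congrArg (ite _ · _) (congrFun h0 m)).trans (ite_self 0)
  obtain ⟨h_le, h_abs⟩ := mem_supportedIn_iff.1 hN j hAj
  rw [Units.val_one, one_mul] at h_le
  exact ⟨(abs_of_nonneg hj₀).trans_le h_le, h_abs⟩

theorem negPart₁_mem_opE (hA : A ∈ opEα0 K 0 (-1)) : negPart₁ A ∈ opE K := by
  obtain ⟨N, hN⟩ := mem_opEα_iff.1 hA.1
  refine (finite_setOf_abs_le 0 N).subset fun j hj => ?_
  obtain ⟨-, hj₀⟩ := mem_supportedIn_iff.1 (negPart₁_mem_supportedIn hA) j hj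
  have hAj : A j ≠ 0 := fun h0 => hj <| funext fun m =>
    (congrArg (ite _ · _) (congrFun h0 m)).trans (ite_self 0)
  obtain ⟨h_le, h_abs⟩ := mem_supportedIn_iff.1 hN j hAj
  rw [Units.val_neg, Units.val_one, neg_one_mul] at h_le
  exact ⟨(abs_of_neg hj₀).trans_le h_le, h_abs⟩

variable (u v) in
theorem isCongruentOnKernels_nonnegPart₁ (hA : A ∈ opEα0 K 0 1) :
    IsCongruentOnKernels u v (nonnegPart₁ A) (A * kernel₁ u v 0) 0 0 where
  mem_opE := nonnegPart₁_mem_opE hA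
  first := by
    refine mul_sub_mul_mem_supportedIn (Fact.out : weight₁ 0 = -((1 : ℤˣ) : ℤ))
      (opE_subset_OpRing 0 1 (nonnegPart₁_mem_opE hA)) hA.1 (kernel₁ u v 0).2
      (s := {j | j 1 = 0 ∧ j 0 < 0}) ?_ (kernel₁_mem_supportedIn u v)
      fun i hi k hk _ => add_neg_of_neg_of_nonpos hi.2 hk
    rw [← neg_sub, sub_eq_of_eq_add' (nonnegPart₁_add_negPart₁ A).symm]
    exact neg_mem (negPart₁_mem_supportedIn hA)
  second := by
    rw [sub_zero]
    exact mul_mem_supportedIn (nonnegPart₁_mem_supportedIn hA) (kernel₂_mem_supportedIn u v)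
      fun i hi k hk => le_add_of_nonneg_of_le hi.1.ge hk
  third := by
    rw [sub_zero]
    exact mul_mem_supportedIn (nonnegPart₁_mem_supportedIn hA) (kernel₃_mem_supportedIn u v)
      fun i hi k hk => add_le_add (hi.1.trans_le hi.2) hk

variable (u v) in
theorem isCongruentOnKernels_negPart₁ (hA : A ∈ opEα0 K 0 (-1)) :
    IsCongruentOnKernels u v (negPart₁ A) 0 0 (A * kernel₃ u v 0) where
  mem_opE := negPart₁_mem_opE hA
  first := by
    rw [sub_zero]
    exact mul_mem_supportedIn (negPart₁_mem_supportedIn hA) (kernel₁_mem_supportedIn u v)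
      fun i hi k hk _ => add_neg_of_neg_of_nonpos hi.2 hk
  second := by
    rw [sub_zero]
    exact mul_mem_supportedIn (negPart₁_mem_supportedIn hA) (kernel₂_mem_supportedIn u v)
      fun i hi k hk => le_add_of_nonneg_of_le hi.1.ge hk
  third := by
    refine mul_sub_mul_mem_supportedIn (Fact.out : weight₃ 0 = -((-1 : ℤˣ) : ℤ))
      (opE_subset_OpRing 0 (-1) (negPart₁_mem_opE hA)) hA.1 (kernel₃ u v 0).2
      (s := {j | j 1 = 0 ∧ 0 ≤ j 0}) ?_ (kernel₃_mem_supportedIn u v)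
      fun i hi k hk => add_le_add (hi.1.trans_le hi.2) hk
    rw [← neg_sub, sub_eq_of_eq_add (nonnegPart₁_add_negPart₁ A).symm]
    exact neg_mem (nonnegPart₁_mem_supportedIn hA)

namespace IsWaveData

variable (h : IsWaveData u v n)

include h

/-- On the line `j 0 = 0` the kernel is constant, and `Δ₂` kills the constants. -/
theorem deltaPosPart_mul_kernel₁_mem (hA : A ∈ opEα0 K 1 ε) :
    deltaPosPart ε A * (kernel₁ u v 0 : FOp K) ∈ supportedIn K {j | j 1 = 0 → j 0 < 0} := by
  have h_support := deltaPosPart_mem_supportedIn hA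
  refine fun j hj => ?_
  obtain ⟨-, hj₀⟩ := Classical.not_imp.1 hj
  rcases (not_lt.1 hj₀).eq_or_lt' with hj₀ | hj₀
  · refine funext fun m => (finsum_congr fun i => ?_).trans (finsum_deltaPosPart hA m)
    by_cases hi : i 0 = 0
    · rw [h.kernel₁_apply (by rw [Pi.sub_apply, hj₀, hi, sub_zero]), mul_one]
    · rw [h_support i fun h0 => hi h0.1, Pi.zero_apply, zero_mul]
  · exact mul_mem_supportedIn (r := {j | j 0 ≤ 0}) h_support (kernel₁_mem_supportedIn u v)
      (fun i hi k hk => add_nonpos hi.1.le hk) j hj₀.not_ge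

theorem isCongruentOnKernels_deltaPosPart_neg_one (hA : A ∈ opEα0 K 1 (-1)) :
    IsCongruentOnKernels u v (deltaPosPart (-1) A) 0 (A * kernel₂ u v 0) 0 where
  mem_opE := deltaPosPart_mem_opE hA
  first := by
    rw [sub_zero]
    exact h.deltaPosPart_mul_kernel₁_mem hA
  second := by
    refine mul_sub_mul_mem_supportedIn (Fact.out : weight₂ 1 = -((-1 : ℤˣ) : ℤ))
      (opE_subset_OpRing 1 (-1) (deltaPosPart_mem_opE hA)) hA.1 (kernel₂ u v 0).2
      (s := {j | 0 ≤ j 1}) ?_ (kernel₂_mem_supportedIn u v)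
      fun i hi k hk => (le_add_of_nonneg_of_le hi hk : 1 ≤ i 1 + k 1)
    rw [← neg_sub]
    refine neg_mem (supportedIn_mono (fun j hj => ?_) (sub_deltaPosPart_mem_supportedIn hA))
    simpa using hj.2
  third := by
    rw [sub_zero]
    refine mul_mem_supportedIn (deltaPosPart_mem_supportedIn hA) (kernel₃_mem_supportedIn u v)
      fun i hi k hk => add_le_add (le_of_le_of_eq ?_ hi.1.symm) hk
    simpa using hi.2

theorem isCongruentOnKernels_deltaPosPart_one (hA : A ∈ opEα0 K 1 1) :
    IsCongruentOnKernels u v (deltaPosPart 1 A) 0 0 (A * kernel₃ u v 0) where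
  mem_opE := deltaPosPart_mem_opE hA
  first := by
    rw [sub_zero]
    exact h.deltaPosPart_mul_kernel₁_mem hA
  second := by
    rw [sub_zero]
    refine mul_mem_supportedIn (deltaPosPart_mem_supportedIn hA) (kernel₂_mem_supportedIn u v)
      fun i hi k hk => (le_add_of_nonneg_of_le ?_ hk : 1 ≤ i 1 + k 1)
    simpa using hi.2
  third := by
    refine mul_sub_mul_mem_supportedIn (Fact.out : weight₃ 1 = -((1 : ℤˣ) : ℤ))
      (opE_subset_OpRing 1 1 (deltaPosPart_mem_opE hA)) hA.1 (kernel₃ u v 0).2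
      (s := {j | j 1 ≤ j 0}) ?_ (kernel₃_mem_supportedIn u v)
      fun i hi k hk => (add_le_add hi hk : i 1 + k 1 ≤ i 0 + k 0)
    rw [← neg_sub]
    refine neg_mem (supportedIn_mono (fun j hj => ?_) (sub_deltaPosPart_mem_supportedIn hA))
    refine le_of_le_of_eq ?_ hj.1.symm
    simpa using hj.2

end IsWaveData

end Congruences

section Hop

variable {K : Type} [Field K] {u v : Fin 3 → ℕ → ZLat → K} {n : Fin 3 → ℕ}

theorem hop_mem_supportedIn (ρ : ZLat → K) :
    hop ρ ∈ supportedIn K {j | 0 ≤ j 1 ∧ j 1 ≤ j 0 ∧ j 0 ≤ 1} := by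
  have h_delta : (shift e₂ - 1 : FOp K) ∈ supportedIn K {j | j 0 = 0 ∧ 0 ≤ j 1 ∧ j 1 ≤ 1} :=
    sub_mem (shift_mem_supportedIn (by simp [e₂])) (scalar_mem_supportedIn (by simp) 1)
  refine add_mem (mul_mem_supportedIn (shift_mem_supportedIn (Set.mem_singleton e₁)) h_delta ?_)
    (scalar_mem_supportedIn (by simp) ρ)
  rintro _ rfl k ⟨hk₀, hk₁, hk₂⟩
  simp [e₁, hk₀, hk₁, hk₂]

theorem hop_mem_opE (ρ : ZLat → K) : hop ρ ∈ opE K := by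
  refine (finite_setOf_abs_le 0 1).subset fun j hj => ?_
  obtain ⟨h₀, h₁, h₂⟩ := mem_supportedIn_iff.1 (hop_mem_supportedIn ρ) j hj
  exact ⟨(abs_of_nonneg (h₀.trans h₁)).trans_le h₂, (abs_of_nonneg h₀).trans_le (h₁.trans h₂)⟩

theorem hop_mul_apply {w : ZLat} [Fact (w 0 = -((1 : ℤˣ) : ℤ))] (ρ : ZLat → K)
    (C : SeriesModule K w) (j m : ZLat) : (hop ρ * (C : FOp K)) j m =
      (C : FOp K) (j - e₁ - e₂) (m + e₁ + e₂) - (C : FOp K) (j - e₁) (m + e₁) +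
        ρ m * (C : FOp K) j m := by
  have h_smul : hopRing 0 1 ρ • C = (monomial K 0 1 (.ofAdd e₁) : OpRing K 0 1) •
      ((monomial K 0 1 (.ofAdd e₂) : OpRing K 0 1) • C - C) +
      (laurentScalar 0 1 ρ : OpRing K 0 1) • C := by
    rw [hopRing, add_smul, mul_smul, sub_smul, one_smul]
  have h_mul : hop ρ * (C : FOp K) =
      shift e₁ * (shift e₂ * (C : FOp K) - (C : FOp K)) + scalar ρ * (C : FOp K) := by
    rw [← coe_hopRing (α := 0) (ε := 1)]
    exact congrArg Subtype.val h_smul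
  rw [h_mul, FOp.add_apply, shift_mul_apply, FOp.sub_apply, shift_mul_apply, scalar_mul_apply]

namespace IsWaveData

variable (h : IsWaveData u v n)

include h

theorem kernel₁_apply_sub_e₁ (m : ZLat) : (kernel₁ u v 0 : FOp K) (0 - e₁) m = 0 := by
  rw [h.kernel₁_apply_eq_add, kernel₂_mem_supportedIn u v _ (by simp [e₁]),
    kernel₃_mem_supportedIn u v _ (by simp [e₁])]
  exact add_zero 0

theorem kernel₁_apply_sub_e₁_sub_e₂ (m : ZLat) :
    (kernel₁ u v 0 : FOp K) (0 - e₁ - e₂) (m + e₁ + e₂) = u 2 0 (m + e₁₂) / u 2 0 m := by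
  have h₃ : (kernel₃ u v 0 : FOp K) (0 - e₁ - e₂) (m + e₁ + e₂) =
      u 2 0 (m + e₁ + e₂) * v 2 0 (m + e₁ + e₂ + e₁ + (0 - e₁ - e₂)) :=
    waveKernel_apply_of_eq_zero _ _ _ (by rw [weight₃_dotProduct]; simp [e₁, e₂])
  rw [h.kernel₁_apply_eq_add, kernel₂_mem_supportedIn u v _ (by simp [e₁, e₂]), Pi.zero_apply,
    zero_add, h₃, show m + e₁ + e₂ + e₁ + (0 - e₁ - e₂) = m + e₁ by abel, e₁₂, ← add_assoc,
    eq_div_iff (h.left_ne_zero 2 m), mul_assoc, mul_comm (v 2 0 (m + e₁)),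
    h.left_two_mul_right_two, mul_one]

variable {ρ : ZLat → K} (hρ : ∀ m, ρ m = -(u 2 0 (m + e₁₂) / u 2 0 m))

include hρ

theorem isCongruentOnKernels_hop : IsCongruentOnKernels u v (hop ρ) 0 0 0 where
  mem_opE := hop_mem_opE ρ
  first := by
    rw [sub_zero]
    refine fun j hj => funext fun m => ?_
    obtain ⟨hj₁, hj₀⟩ := Classical.not_imp.1 hj
    rw [hop_mul_apply, Pi.zero_apply]
    obtain hj₀ | hj₀ | hj₀ : j 0 = 0 ∨ j 0 = 1 ∨ 1 < j 0 := by lia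
    · obtain rfl : j = 0 := funext (Fin.forall_fin_two.2 ⟨hj₀, hj₁⟩)
      rw [h.kernel₁_apply_sub_e₁_sub_e₂, h.kernel₁_apply_sub_e₁, h.kernel₁_apply rfl, hρ,
        mul_one, sub_zero, add_neg_cancel]
    · rw [h.kernel₁_apply (by simp [hj₀, e₁, e₂]), h.kernel₁_apply (by simp [hj₀, e₁]),
        kernel₁_mem_supportedIn u v j (by simp [hj₀]), Pi.zero_apply, mul_zero, sub_self, add_zero]
    · have h_zero : ∀ i : ZLat, i 0 ≤ 1 → (kernel₁ u v 0 : FOp K) (j - i) = 0 := fun i hi =>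
        kernel₁_mem_supportedIn u v _ (not_le.2 (sub_pos.2 (hi.trans_lt hj₀)))
      rw [sub_sub, h_zero (e₁ + e₂) (by simp [e₁, e₂]), h_zero e₁ (by simp [e₁]), ← sub_zero j,
        h_zero 0 (by simp), Pi.zero_apply, Pi.zero_apply, Pi.zero_apply, mul_zero, sub_self,
        add_zero]
  second := by
    rw [sub_zero]
    exact mul_mem_supportedIn (hop_mem_supportedIn ρ) (kernel₂_mem_supportedIn u v)
      fun i hi k hk => le_add_of_nonneg_of_le hi.1 hk
  third := by
    rw [sub_zero]
    exact mul_mem_supportedIn (hop_mem_supportedIn ρ) (kernel₃_mem_supportedIn u v)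
      fun i hi k hk => add_le_add hi.2.1 hk

end IsWaveData

end Hop

section LaxSum

variable {K : Type} [Field K] {u v : Fin 3 → ℕ → ZLat → K} {n : Fin 3 → ℕ}

/-- The analogue of `𝓛` for wave coefficients `u` that need not come from a tau function. -/
def laxSum (u : Fin 3 → ℕ → ZLat → K) (n : Fin 3 → ℕ) : FOp K :=
  nonnegPart₁ ((laxSeries 0 1 (u 0) : FOp K) ^ n 0) +
    deltaPosPart (-1) ((laxSeries 1 (-1) (u 1) : FOp K) ^ n 1) +
    negPart₁ ((laxSeries 0 (-1) (u 2) : FOp K) ^ n 2)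

/-- The analogue of `𝓛̃` for wave coefficients `u` that need not come from a tau function. -/
def laxSum' (u : Fin 3 → ℕ → ZLat → K) (n : Fin 3 → ℕ) : FOp K :=
  nonnegPart₁ ((laxSeries 0 1 (u 0) : FOp K) ^ n 0) +
    deltaPosPart (-1) ((laxSeries 1 (-1) (u 1) : FOp K) ^ n 1) +
    deltaPosPart 1 ((laxSeries 1 1 (u 2) : FOp K) ^ n 2)

theorem coe_laxSeries_pow {α : Fin 2} {ε : ℤˣ} (u : ℕ → ZLat → K) (n : ℕ) :
    ((laxSeries α ε u ^ n : laurentSubring K α ε) : FOp K) = (laxSeries α ε u : FOp K) ^ n :=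
  OpRing.coe_pow _ n

theorem laxSeries_pow_mem_opEα0 {α : Fin 2} {ε : ℤˣ} (u : ℕ → ZLat → K) (n : ℕ) :
    (laxSeries α ε u : FOp K) ^ n ∈ opEα0 K α ε :=
  mem_opEα0_iff.2 ⟨laxSeries α ε u ^ n, coe_laxSeries_pow u n⟩

theorem laxSeries_pow_mul_waveKernel {α : Fin 2} {ε : ℤˣ} {w : ZLat} [Fact (w α = -ε)]
    {u : ℕ → ZLat → K} (hu : ∀ m, u 0 m ≠ 0) (n : ℕ) (c : ℤ) (v : ℕ → ZLat → K) :
    (laxSeries α ε u : FOp K) ^ n * (waveKernel w c u v : FOp K) = waveKernel w (c + n) u v := by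
  rw [← coe_laxSeries_pow]
  exact congrArg Subtype.val (laxSeries_pow_smul_waveKernel (α := α) (ε := ε) hu n c v)

theorem proj_hop_eq_laxSeries_pow {α : Fin 2} {ε : ℤˣ} {w : ZLat} [Fact (w α = -ε)] {c : ℤ}
    {u v : ℕ → ZLat → K} (hu : ∀ m, u 0 m ≠ 0) (hv : ∀ m, v 0 m ≠ 0) {ρ : ZLat → K}
    (h_dec : DirectSumDecomposition α ε (hop ρ))
    (h_hop : hop ρ * (waveKernel w c u v : FOp K) = 0) {A : FOp K} (hA : A ∈ opE K) {n : ℕ}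
    (h : A * (waveKernel w c u v : FOp K) = waveKernel w (c + n) u v) :
    proj α ε (hop ρ) A = (laxSeries α ε u : FOp K) ^ n := by
  rw [← laxSeries_pow_mul_waveKernel (α := α) (ε := ε) hu, ← coe_laxSeries_pow] at h
  rw [← coe_laxSeries_pow]
  exact proj_eq_of_smul_eq (D := hopRing α ε ρ) (A := ⟨A, opE_subset_OpRing α ε hA⟩) h_dec
    (Subtype.ext h_hop) (isUnit_rowMap_waveKernel c hu hv) (Subtype.ext h)

theorem directSumDecomposition_hop {α : Fin 2} {ε : ℤˣ} {w : ZLat} [Fact (w α = -ε)] {c : ℤ}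
    {u v : ℕ → ZLat → K} (hu : ∀ m, u 0 m ≠ 0) (hv : ∀ m, v 0 m ≠ 0) {ρ : ZLat → K}
    (hρ : ∀ m, ρ m ≠ 0) (h_hop : hop ρ * (waveKernel w c u v : FOp K) = 0) :
    DirectSumDecomposition α ε (hop ρ) := by
  obtain ⟨x, y, hxy⟩ := exists_hopRing_eq (α := α) (ε := ε) hρ
  exact directSumDecomposition (D := hopRing α ε ρ) hxy (Subtype.ext h_hop)
    (isUnit_rowMap_waveKernel c hu hv)

namespace IsWaveData

variable (h : IsWaveData u v n)

include h

theorem laxSeries_pow_mul_kernel₁ :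
    (laxSeries 0 1 (u 0) : FOp K) ^ n 0 * (kernel₁ u v 0 : FOp K) = kernel₁ u v (n 0) :=
  (laxSeries_pow_mul_waveKernel (h.left_ne_zero 0) (n 0) 0 (v 0)).trans (by rw [zero_add]; rfl)

theorem laxSeries_pow_mul_kernel₂ :
    (laxSeries 1 (-1) (u 1) : FOp K) ^ n 1 * (kernel₂ u v 0 : FOp K) = kernel₂ u v (n 1) :=
  (laxSeries_pow_mul_waveKernel (h.left_ne_zero 1) (n 1) (0 - 1) (v 1)).trans
    (by rw [sub_add_eq_add_sub, zero_add]; rfl)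

theorem laxSeries_pow_mul_kernel₃ {α : Fin 2} {ε : ℤˣ} [Fact (weight₃ α = -ε)] :
    (laxSeries α ε (u 2) : FOp K) ^ n 2 * (kernel₃ u v 0 : FOp K) = kernel₃ u v (n 2) :=
  (laxSeries_pow_mul_waveKernel (h.left_ne_zero 2) (n 2) 0 (v 2)).trans (by rw [zero_add]; rfl)

theorem isCongruentOnKernels_laxSum : IsCongruentOnKernels u v (laxSum u n)
    (kernel₁ u v (n 0)) (kernel₂ u v (n 1)) (kernel₃ u v (n 2)) := by
  have h_add := ((isCongruentOnKernels_nonnegPart₁ u v (laxSeries_pow_mem_opEα0 (u 0) (n 0))).add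
    (h.isCongruentOnKernels_deltaPosPart_neg_one (laxSeries_pow_mem_opEα0 (u 1) (n 1)))).add
    (isCongruentOnKernels_negPart₁ u v (laxSeries_pow_mem_opEα0 (u 2) (n 2)))
  simpa only [laxSum, h.laxSeries_pow_mul_kernel₁, h.laxSeries_pow_mul_kernel₂,
    h.laxSeries_pow_mul_kernel₃, zero_add, add_zero] using h_add

theorem isCongruentOnKernels_laxSum' : IsCongruentOnKernels u v (laxSum' u n)
    (kernel₁ u v (n 0)) (kernel₂ u v (n 1)) (kernel₃ u v (n 2)) := by
  have h_add := ((isCongruentOnKernels_nonnegPart₁ u v (laxSeries_pow_mem_opEα0 (u 0) (n 0))).add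
    (h.isCongruentOnKernels_deltaPosPart_neg_one (laxSeries_pow_mem_opEα0 (u 1) (n 1)))).add
    (h.isCongruentOnKernels_deltaPosPart_one (laxSeries_pow_mem_opEα0 (u 2) (n 2)))
  simpa only [laxSum', h.laxSeries_pow_mul_kernel₁, h.laxSeries_pow_mul_kernel₂,
    h.laxSeries_pow_mul_kernel₃, zero_add, add_zero] using h_add

section Projections

variable {ρ : ZLat → K} (hρ : ∀ m, ρ m = -(u 2 0 (m + e₁₂) / u 2 0 m))

include hρ

theorem hop_mul_kernel : hop ρ * (kernel₁ u v 0 : FOp K) = 0 ∧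
    hop ρ * (kernel₂ u v 0 : FOp K) = 0 ∧ hop ρ * (kernel₃ u v 0 : FOp K) = 0 :=
  (h.isCongruentOnKernels_hop hρ).mul_kernel_eq h (add_zero 0).symm
    (M₁ := 0) (congrArg Subtype.val (zero_smul (OpRing K 0 1) (kernel₁ u v 0)))
    (M₂ := 0) (congrArg Subtype.val (zero_smul (OpRing K 1 (-1)) (kernel₂ u v 0)))

theorem directSumDecomposition_hop (α : Fin 2) (ε : ℤˣ) :
    DirectSumDecomposition α ε (hop ρ) := by
  have h_ne (m : ZLat) : ρ m ≠ 0 :=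
    hρ m ▸ neg_ne_zero.2 (div_ne_zero (h.left_ne_zero 2 _) (h.left_ne_zero 2 m))
  obtain ⟨h₁, h₂, h₃⟩ := h.hop_mul_kernel hρ
  have h_dec₃ [Fact (weight₃ α = -ε)] : DirectSumDecomposition α ε (hop ρ) :=
    ThreeKP.directSumDecomposition_hop (h.left_ne_zero 2) (h.right_ne_zero 2) h_ne h₃
  match α with
  | 0 =>
    obtain rfl | rfl := Int.units_eq_one_or ε
    · exact ThreeKP.directSumDecomposition_hop (h.left_ne_zero 0) (h.right_ne_zero 0) h_ne h₁
    · exact h_dec₃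
  | 1 =>
    obtain rfl | rfl := Int.units_eq_one_or ε
    · exact h_dec₃
    · exact ThreeKP.directSumDecomposition_hop (h.left_ne_zero 1) (h.right_ne_zero 1) h_ne h₂

theorem proj_hop_eq {A : FOp K} (hA : IsCongruentOnKernels u v A
    (kernel₁ u v (n 0)) (kernel₂ u v (n 1)) (kernel₃ u v (n 2))) :
    proj 0 1 (hop ρ) A = (laxSeries 0 1 (u 0) : FOp K) ^ n 0 ∧
      proj 0 (-1) (hop ρ) A = (laxSeries 0 (-1) (u 2) : FOp K) ^ n 2 ∧
      proj 1 1 (hop ρ) A = (laxSeries 1 1 (u 2) : FOp K) ^ n 2 ∧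
      proj 1 (-1) (hop ρ) A = (laxSeries 1 (-1) (u 1) : FOp K) ^ n 1 := by
  have h_dec := h.directSumDecomposition_hop hρ
  obtain ⟨h₁, h₂, h₃⟩ := h.hop_mul_kernel hρ
  obtain ⟨hA₁, hA₂, hA₃⟩ := hA.mul_kernel_eq h h.bilinear_one
    (M₁ := (laxSeries 0 1 (u 0) : OpRing K 0 1) ^ n 0)
    (by rw [OpRing.coe_pow, h.laxSeries_pow_mul_kernel₁])
    (M₂ := (laxSeries 1 (-1) (u 1) : OpRing K 1 (-1)) ^ n 1)
    (by rw [OpRing.coe_pow, h.laxSeries_pow_mul_kernel₂])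
  have hA₂' : A * (waveKernel weight₂ (0 - 1) (u 1) (v 1) : FOp K) =
      waveKernel weight₂ (0 - 1 + n 1) (u 1) (v 1) := by
    rw [sub_add_eq_add_sub, zero_add]
    exact hA₂
  rw [← zero_add (n 0 : ℤ)] at hA₁
  rw [← zero_add (n 2 : ℤ)] at hA₃
  exact ⟨proj_hop_eq_laxSeries_pow (h.left_ne_zero 0) (h.right_ne_zero 0) (h_dec 0 1) h₁
      hA.mem_opE hA₁,
    proj_hop_eq_laxSeries_pow (h.left_ne_zero 2) (h.right_ne_zero 2) (h_dec 0 (-1)) h₃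
      hA.mem_opE hA₃,
    proj_hop_eq_laxSeries_pow (h.left_ne_zero 2) (h.right_ne_zero 2) (h_dec 1 1) h₃
      hA.mem_opE hA₃,
    proj_hop_eq_laxSeries_pow (h.left_ne_zero 1) (h.right_ne_zero 1) (h_dec 1 (-1)) h₂
      hA.mem_opE hA₂'⟩

end Projections

end IsWaveData

theorem mainTheorem12_general (h : IsWaveData u v n) {ρ : ZLat → K}
    (hρ : ∀ m, ρ m = -(u 2 0 (m + e₁₂) / u 2 0 m)) :
    (∀ (α : Fin 2) (ε : ℤˣ), DirectSumDecomposition α ε (hop ρ)) ∧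
    (laxSum u n ∈ opE K ∧ laxSum' u n ∈ opE K) ∧
    (proj 0 1 (hop ρ) (laxSum u n) = (laxSeries 0 1 (u 0) : FOp K) ^ n 0 ∧
      proj 0 1 (hop ρ) (laxSum' u n) = (laxSeries 0 1 (u 0) : FOp K) ^ n 0) ∧
    (proj 0 (-1) (hop ρ) (laxSum u n) = (laxSeries 0 (-1) (u 2) : FOp K) ^ n 2 ∧
      proj 0 (-1) (hop ρ) (laxSum' u n) = (laxSeries 0 (-1) (u 2) : FOp K) ^ n 2) ∧
    (proj 1 1 (hop ρ) (laxSum u n) = (laxSeries 1 1 (u 2) : FOp K) ^ n 2 ∧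
      proj 1 1 (hop ρ) (laxSum' u n) = (laxSeries 1 1 (u 2) : FOp K) ^ n 2) ∧
    (proj 1 (-1) (hop ρ) (laxSum u n) = (laxSeries 1 (-1) (u 1) : FOp K) ^ n 1 ∧
      proj 1 (-1) (hop ρ) (laxSum' u n) = (laxSeries 1 (-1) (u 1) : FOp K) ^ n 1) := by
  have h_sum := h.isCongruentOnKernels_laxSum
  have h_sum' := h.isCongruentOnKernels_laxSum'
  obtain ⟨h₁, h₃, h₄, h₂⟩ := h.proj_hop_eq hρ h_sum
  obtain ⟨h₁', h₃', h₄', h₂'⟩ := h.proj_hop_eq hρ h_sum'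
  exact ⟨h.directSumDecomposition_hop hρ, ⟨h_sum.mem_opE, h_sum'.mem_opE⟩, ⟨h₁, h₁'⟩,
    ⟨h₃, h₃'⟩, ⟨h₄, h₄'⟩, h₂, h₂'⟩

end LaxSum

/-! ### The bilinear residue on the diagonal -/

section Diagonal

theorem hasSubst_inl :
    MvPowerSeries.HasSubst (fun s : Time => (MvPowerSeries.X (Sum.inl s) : TTSeries)) where
  const_coeff s := by simp
  coeff_zero d := (MvPowerSeries.HasSubst.X.coeff_zero d).preimage Sum.inl_injective.injOn

theorem hasSubst_inr :
    MvPowerSeries.HasSubst (fun s : Time => (MvPowerSeries.X (Sum.inr s) : TTSeries)) where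
  const_coeff s := by simp
  coeff_zero d := (MvPowerSeries.HasSubst.X.coeff_zero d).preimage Sum.inr_injective.injOn

theorem hasSubst_sumElim_X :
    MvPowerSeries.HasSubst (Sum.elim MvPowerSeries.X MvPowerSeries.X : Time ⊕ Time → TSeries) where
  const_coeff s := by rcases s with s | s <;> simp
  coeff_zero d := by
    have hX : {s : Time | MvPowerSeries.coeff d (MvPowerSeries.X s : TSeries) ≠ 0}.Finite :=
      MvPowerSeries.HasSubst.X.coeff_zero d
    refine ((hX.image Sum.inl).union (hX.image Sum.inr)).subset ?_
    rintro (s | s) hs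
    · exact Or.inl ⟨s, hs, rfl⟩
    · exact Or.inr ⟨s, hs, rfl⟩

/-- The restriction of a series in `t, t'` to the diagonal `t' = t`. -/
def diag : TTSeries →ₐ[ℂ] TSeries := MvPowerSeries.substAlgHom hasSubst_sumElim_X

theorem diag_X (s : Time ⊕ Time) :
    diag (MvPowerSeries.X s) = Sum.elim MvPowerSeries.X MvPowerSeries.X s := by
  rw [diag, MvPowerSeries.substAlgHom_apply, MvPowerSeries.subst_X hasSubst_sumElim_X]

theorem diag_inT (f : TSeries) : diag (inT f) = f := by
  rw [diag, MvPowerSeries.substAlgHom_apply, inT,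
    MvPowerSeries.subst_comp_subst_apply hasSubst_inl hasSubst_sumElim_X]
  simp only [MvPowerSeries.subst_X hasSubst_sumElim_X, Sum.elim_inl]
  exact congrFun MvPowerSeries.subst_self f

theorem diag_inT' (f : TSeries) : diag (inT' f) = f := by
  rw [diag, MvPowerSeries.substAlgHom_apply, inT',
    MvPowerSeries.subst_comp_subst_apply hasSubst_inr hasSubst_sumElim_X]
  simp only [MvPowerSeries.subst_X hasSubst_sumElim_X, Sum.elim_inr]
  exact congrFun MvPowerSeries.subst_self f

theorem map_diag_xi (i : Fin 3) : PowerSeries.map diag.toRingHom (xi i) = 0 := by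
  ext1 k
  rw [PowerSeries.coeff_map, xi, PowerSeries.coeff_mk]
  rcases k with _ | k
  · simp
  · simp [diag_X]

theorem diag_coeff_xi_pow (i : Fin 3) (r k : ℕ) :
    diag (PowerSeries.coeff r (xi i ^ k)) = if r = 0 ∧ k = 0 then 1 else 0 := by
  have hmap : diag (PowerSeries.coeff r (xi i ^ k)) =
      PowerSeries.coeff r ((0 : PowerSeries TSeries) ^ k) := by
    rw [← map_diag_xi i, ← map_pow, PowerSeries.coeff_map]
    rfl
  rw [hmap]
  rcases k with _ | k
  · simp [PowerSeries.coeff_one]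
  · simp

theorem diag_coeff_expXi (i : Fin 3) (r : ℕ) :
    diag (PowerSeries.coeff r (expXi i)) = if r = 0 then 1 else 0 := by
  rw [expXi, PowerSeries.coeff_mk, map_sum]
  simp only [map_smul, diag_coeff_xi_pow]
  rcases r with _ | r
  · simp
  · simp

theorem le_weightedOrder_sum {σ R ι : Type*} [Semiring R] (w : σ → ℕ) {n : ℕ∞} (s : Finset ι)
    {F : ι → MvPowerSeries σ R} (hF : ∀ x ∈ s, n ≤ (F x).weightedOrder w) :
    n ≤ (∑ x ∈ s, F x).weightedOrder w :=
  Finset.sum_induction _ (fun G : MvPowerSeries σ R => n ≤ G.weightedOrder w)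
    (fun _ _ hG hG' => (le_min hG hG').trans (MvPowerSeries.min_weightedOrder_le_add w))
    (by simp) hF

theorem weightedOrder_X {σ R : Type*} [Semiring R] [Nontrivial R] (w : σ → ℕ) (s : σ) :
    (MvPowerSeries.X s : MvPowerSeries σ R).weightedOrder w = w s := by
  rw [MvPowerSeries.X, MvPowerSeries.weightedOrder_monomial_of_ne_zero _ one_ne_zero,
    Finsupp.weight_single, smul_eq_mul, one_mul]

/-- The grading of the series in `t` in which `t^{(i)}_k` has weight `k`. -/
def timeWeight (s : Time) : ℕ := s.2 + 1

/-- The grading of the series in `t, t'` in which `t^{(i)}_k` and `t'^{(i)}_k` have weight `k`. -/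
def pairWeight : Time ⊕ Time → ℕ := Sum.elim timeWeight timeWeight

theorem le_weightedOrder_coeff_xi (i : Fin 3) (r : ℕ) :
    (r : ℕ∞) ≤ (PowerSeries.coeff r (xi i)).weightedOrder pairWeight := by
  rw [xi, PowerSeries.coeff_mk]
  rcases r with _ | r
  · simp
  · refine MvPowerSeries.le_weightedOrder _ fun d hd => ?_
    have hX (s : Time ⊕ Time) (hs : pairWeight s = r + 1) :
        MvPowerSeries.coeff d (MvPowerSeries.X s : TTSeries) = 0 :=
      MvPowerSeries.coeff_eq_zero_of_lt_weightedOrder pairWeight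
        (by rwa [weightedOrder_X, hs])
    rw [map_sub, hX _ rfl, hX _ rfl, sub_zero]

theorem le_weightedOrder_coeff_xi_pow (i : Fin 3) (k r : ℕ) :
    (r : ℕ∞) ≤ (PowerSeries.coeff r (xi i ^ k)).weightedOrder pairWeight := by
  induction k generalizing r with
  | zero =>
    rw [pow_zero, PowerSeries.coeff_one]
    split_ifs with hr
    · simp [hr]
    · simp
  | succ k ih =>
    rw [pow_succ, PowerSeries.coeff_mul]
    refine le_weightedOrder_sum _ _ fun x hx => ?_
    rw [← Finset.HasAntidiagonal.mem_antidiagonal.1 hx, Nat.cast_add]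
    exact (add_le_add (ih x.1) (le_weightedOrder_coeff_xi i x.2)).trans
      (MvPowerSeries.le_weightedOrder_mul pairWeight)

theorem le_weightedOrder_coeff_expXi (i : Fin 3) (r : ℕ) :
    (r : ℕ∞) ≤ (PowerSeries.coeff r (expXi i)).weightedOrder pairWeight := by
  rw [expXi, PowerSeries.coeff_mk]
  exact le_weightedOrder_sum _ _ fun k _ =>
    (le_weightedOrder_coeff_xi_pow i k r).trans (MvPowerSeries.le_weightedOrder_smul pairWeight)

theorem weightedOrder_le_diag (F : TTSeries) :
    F.weightedOrder pairWeight ≤ (diag F).weightedOrder timeWeight := by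
  have hX (s : Time) : (MvPowerSeries.X s : TSeries) ≠ 0 := by
    rw [ne_eq, ← MvPowerSeries.weightedOrder_eq_top_iff timeWeight, weightedOrder_X]
    exact ENat.natCast_ne_top _
  have hweight : ENat.toNat ∘ MvPowerSeries.weightedOrder timeWeight ∘
      (Sum.elim MvPowerSeries.X MvPowerSeries.X : Time ⊕ Time → TSeries) = pairWeight := by
    funext s
    rcases s with s | s <;> simp [weightedOrder_X, pairWeight]
  have hle := MvPowerSeries.le_weightedOrder_subst_of_forall_ne_zero timeWeight
    hasSubst_sumElim_X (by rintro (s | s) <;> exact hX s) F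
  rwa [hweight, ← MvPowerSeries.substAlgHom_apply] at hle

theorem coeff_diag_congr {F G : TTSeries} {e : Time →₀ ℕ}
    (h : ∀ d, Finsupp.weight pairWeight d ≤ Finsupp.weight timeWeight e →
      MvPowerSeries.coeff d F = MvPowerSeries.coeff d G) :
    MvPowerSeries.coeff e (diag F) = MvPowerSeries.coeff e (diag G) := by
  have hFG : ((Finsupp.weight timeWeight e + 1 : ℕ) : ℕ∞) ≤ (F - G).weightedOrder pairWeight :=
    MvPowerSeries.le_weightedOrder _ fun d hd => by
      rw [map_sub, h d (Nat.lt_succ_iff.1 (by exact_mod_cast hd)), sub_self]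
  have hlt : (Finsupp.weight timeWeight e : ℕ∞) < (diag (F - G)).weightedOrder timeWeight :=
    (by exact_mod_cast Nat.lt_succ_self _ :
      (Finsupp.weight timeWeight e : ℕ∞) < (Finsupp.weight timeWeight e + 1 : ℕ)).trans_le
      (hFG.trans (weightedOrder_le_diag _))
  rw [← sub_eq_zero, ← map_sub, ← map_sub]
  exact MvPowerSeries.coeff_eq_zero_of_lt_weightedOrder timeWeight hlt

/-- The coefficient of the powers with exponents `x = (r, p, q)` in
`exp ξ(t^{(i)} - t'^{(i)}, w) f(t - [w']_i) g(t' + [w'']_i)`; the residue is a sum of such terms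
with `p + q - r` fixed. -/
def residueTerm (i : Fin 3) (f g : TSeries) (x : ℕ × ℕ × ℕ) : TTSeries :=
  PowerSeries.coeff x.1 (expXi i) * inT (PowerSeries.coeff x.2.1 (miwa i (-1) f)) *
    inT' (PowerSeries.coeff x.2.2 (miwa i 1 g))

theorem diag_residueTerm (i : Fin 3) (f g : TSeries) (x : ℕ × ℕ × ℕ) :
    diag (residueTerm i f g x) = if x.1 = 0 then
      PowerSeries.coeff x.2.1 (miwa i (-1) f) * PowerSeries.coeff x.2.2 (miwa i 1 g) else 0 := by
  rw [residueTerm, map_mul, map_mul, diag_inT, diag_inT', diag_coeff_expXi]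
  split_ifs <;> simp

theorem le_weightedOrder_residueTerm (i : Fin 3) (f g : TSeries) (x : ℕ × ℕ × ℕ) :
    (x.1 : ℕ∞) ≤ (residueTerm i f g x).weightedOrder pairWeight :=
  (le_weightedOrder_coeff_expXi i x.1).trans <|
    le_self_add.trans <| (MvPowerSeries.le_weightedOrder_mul pairWeight).trans <|
      le_self_add.trans (MvPowerSeries.le_weightedOrder_mul pairWeight)

/-- The exponents `(r, p, q)` with `p + q - r = N` and `r ≤ W`: those whose terms contribute to
the part of weight at most `W` of a residue. -/
def residueIndex (N : ℤ) (W : ℕ) : Finset (ℕ × ℕ × ℕ) :=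
  (Finset.range (W + 1) ×ˢ Finset.range (W + N.natAbs + 1) ×ˢ
    Finset.range (W + N.natAbs + 1)).filter fun x => (x.2.1 : ℤ) + x.2.2 = x.1 + N

theorem mem_residueIndex {N : ℤ} {W : ℕ} {x : ℕ × ℕ × ℕ} :
    x ∈ residueIndex N W ↔ x.1 ≤ W ∧ (x.2.1 : ℤ) + x.2.2 = x.1 + N := by
  simp only [residueIndex, Finset.mem_filter, Finset.mem_product, Finset.mem_range]
  omega

theorem sum_residueIndex_ite {R : Type*} [Semiring R] (u v : ℕ → R) (N : ℤ) (W : ℕ) :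
    ∑ x ∈ residueIndex N W, (if x.1 = 0 then u x.2.1 * v x.2.2 else 0) = convol u v N := by
  rw [← Finset.sum_filter, convol]
  split_ifs with hN
  · refine Finset.sum_bij' (fun x _ => x.2) (fun y _ => (0, y)) ?_ ?_ ?_ (fun _ _ => rfl)
      (fun _ _ => rfl)
    · intro x hx
      rw [Finset.mem_filter, mem_residueIndex] at hx
      rw [Finset.HasAntidiagonal.mem_antidiagonal]
      omega
    · intro y hy
      rw [Finset.HasAntidiagonal.mem_antidiagonal] at hy
      rw [Finset.mem_filter, mem_residueIndex]
      exact ⟨⟨Nat.zero_le W, by push_cast; omega⟩, rfl⟩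
    · intro x hx
      exact Prod.ext (Finset.mem_filter.1 hx).2.symm rfl
  · refine Finset.sum_eq_zero fun x hx => ?_
    rw [Finset.mem_filter, mem_residueIndex] at hx
    omega

theorem coeff_residue_eq_coeff_sum (i : Fin 3) (s : ℤˣ) (a : ℤ) (f g : TSeries) {W : ℕ}
    {d : Time ⊕ Time →₀ ℕ} (hd : Finsupp.weight pairWeight d ≤ W) :
    MvPowerSeries.coeff d (residue i s a f g) =
      MvPowerSeries.coeff d (∑ x ∈ residueIndex (s * (a + 1)) W, residueTerm i f g x) := by
  have hexp (x : ℕ × ℕ × ℕ) : a + s * ((x.1 : ℤ) - x.2.1 - x.2.2) = -1 ↔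
      (x.2.1 : ℤ) + x.2.2 = x.1 + s * (a + 1) := by
    rcases Int.units_eq_one_or s with rfl | rfl <;>
      simp only [Units.val_one, Units.val_neg] <;> omega
  change (∑ᶠ x : ℕ × ℕ × ℕ, if a + s * ((x.1 : ℤ) - x.2.1 - x.2.2) = -1 then
    MvPowerSeries.coeff d (residueTerm i f g x) else 0) = _
  rw [finsum_eq_sum_of_support_subset (s := residueIndex (s * (a + 1)) W), map_sum]
  · exact Finset.sum_congr rfl fun x hx => if_pos ((hexp x).2 (mem_residueIndex.1 hx).2)
  · intro x hx
    rw [Function.mem_support, ne_eq, ite_eq_right_iff, Classical.not_imp] at hx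
    refine mem_residueIndex.2 ⟨?_, (hexp x).1 hx.1⟩
    by_contra! hlt
    exact hx.2 <| MvPowerSeries.coeff_eq_zero_of_lt_weightedOrder pairWeight <|
      (by exact_mod_cast hd.trans_lt hlt :
        (Finsupp.weight pairWeight d : ℕ∞) < x.1).trans_le (le_weightedOrder_residueTerm i f g x)

theorem diag_residue (i : Fin 3) (s : ℤˣ) (a : ℤ) (f g : TSeries) :
    diag (residue i s a f g) =
      convol (fun p => PowerSeries.coeff p (miwa i (-1) f))
        (fun q => PowerSeries.coeff q (miwa i 1 g)) (s * (a + 1)) := by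
  ext e
  rw [coeff_diag_congr fun d hd => coeff_residue_eq_coeff_sum i s a f g hd, map_sum,
    ← sum_residueIndex_ite _ _ _ (Finsupp.weight timeWeight e)]
  simp only [diag_residueTerm]

end Diagonal

section Miwa

/-- The series `t^{(j)}_k + c δ_{ij} w^k / k` substituted for `t^{(j)}_k` in `miwa i c`. -/
def miwaSubst (i : Fin 3) (c : ℂ) (s : Time) : MvPowerSeries (Option Time) ℂ :=
  MvPowerSeries.X (some s) +
    if s.1 = i then
      MvPowerSeries.C (c / ((s.2 : ℂ) + 1)) * MvPowerSeries.X none ^ (s.2 + 1)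
    else 0

theorem hasSubst_miwaSubst (i : Fin 3) (c : ℂ) : MvPowerSeries.HasSubst (miwaSubst i c) := by
  refine MvPowerSeries.HasSubst.add ⟨fun s => by simp, fun d =>
    (MvPowerSeries.HasSubst.X.coeff_zero d).preimage (Option.some_injective _).injOn⟩
    ⟨fun s => by split_ifs <;> simp, fun d => ?_⟩
  refine (Set.finite_singleton ((i, d none - 1) : Time)).subset fun s hs => ?_
  rw [Set.mem_ofPred_eq] at hs
  split_ifs at hs with hi
  · rw [MvPowerSeries.coeff_C_mul, MvPowerSeries.X_pow_eq, MvPowerSeries.coeff_monomial] at hs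
    split_ifs at hs with hd
    · rw [hd]
      simp [← hi]
    · simp at hs
  · simp at hs

theorem constantCoeff_optionEquivLeft_miwaSubst (i : Fin 3) (c : ℂ) (s : Time) :
    PowerSeries.constantCoeff (MvPowerSeries.optionEquivLeft Time ℂ (miwaSubst i c s)) =
      MvPowerSeries.X s := by
  rw [miwaSubst, map_add, map_add, MvPowerSeries.optionEquivLeft_X_some]
  split_ifs <;> simp [MvPowerSeries.optionEquivLeft_X_none]

theorem coeff_optionElim_prod_miwaSubst (i : Fin 3) (c : ℂ) (d e : Time →₀ ℕ) :
    MvPowerSeries.coeff (e.optionElim 0) (d.prod fun s k => miwaSubst i c s ^ k) =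
      if e = d then 1 else 0 := by
  have hconst (G : MvPowerSeries (Option Time) ℂ) : MvPowerSeries.coeff (e.optionElim 0) G =
      MvPowerSeries.coeff e
        (PowerSeries.constantCoeff (MvPowerSeries.optionEquivLeft Time ℂ G)) := by
    rw [← PowerSeries.coeff_zero_eq_constantCoeff_apply,
      MvPowerSeries.coeff_coeff_optionEquivLeft]
  rw [hconst, map_finsuppProd, map_finsuppProd]
  simp only [map_pow, constantCoeff_optionEquivLeft_miwaSubst]
  rw [← MvPowerSeries.monomial_one_eq, MvPowerSeries.coeff_monomial]

theorem coeff_zero_miwa (i : Fin 3) (c : ℂ) (f : TSeries) :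
    PowerSeries.coeff 0 (miwa i c f) = f := by
  ext e
  change MvPowerSeries.coeff e (PowerSeries.coeff 0
    (MvPowerSeries.optionEquivLeft Time ℂ (MvPowerSeries.subst (miwaSubst i c) f))) = _
  rw [MvPowerSeries.coeff_coeff_optionEquivLeft,
    MvPowerSeries.coeff_subst (hasSubst_miwaSubst i c)]
  simp only [coeff_optionElim_prod_miwaSubst]
  rw [finsum_eq_single _ e fun d hd => by rw [if_neg hd.symm, smul_zero], if_pos rfl,
    smul_eq_mul, mul_one]

end Miwa

/-! ### The wave coefficients of a tau function -/

section Convolution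

variable {R S : Type*} [CommSemiring R] [CommSemiring S]

theorem convol_mul_mul (a b : R) (f g : ℕ → R) (N : ℤ) :
    convol (fun p => a * f p) (fun q => b * g q) N = a * b * convol f g N := by
  unfold convol
  split_ifs
  · rw [Finset.mul_sum]
    exact Finset.sum_congr rfl fun x _ => mul_mul_mul_comm _ _ _ _
  · rw [mul_zero]

theorem map_convol (φ : R →+* S) (f g : ℕ → R) (N : ℤ) :
    φ (convol f g N) = convol (fun p => φ (f p)) (fun q => φ (g q)) N := by
  unfold convol
  split_ifs
  · rw [map_sum]
    exact Finset.sum_congr rfl fun x _ => map_mul φ _ _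
  · exact map_zero φ

end Convolution

section Tau

variable {n : Fin 3 → ℕ} (τ : ZLat → TSeries)

/-- The coefficient of `w^k` in `f(t + [w]_i) / τ_m(t)`, dual to `waveCoeff`. -/
def dualCoeff (i : Fin 3) (f : TSeries) (m : ZLat) (k : ℕ) : TField :=
  algebraMap TSeries TField (PowerSeries.coeff k (miwa i 1 f)) / algebraMap TSeries TField (τ m)

/-- The coefficients of the operators `S₁, S₂, S₃` of `τ`. -/
def waveData : Fin 3 → ℕ → ZLat → TField :=
  ![fun k m => waveCoeff τ 0 (τ m) m k, fun k m => waveCoeff τ 1 (τ (m + e₁₂)) m k, s₃ τ]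

/-- The coefficients of the dual wave functions of `τ`, obtained from the second tau functions in
the three integrands of the bilinear equations. -/
def dualData : Fin 3 → ℕ → ZLat → TField :=
  ![fun k m => dualCoeff τ 0 (τ m) m k, fun k m => dualCoeff τ 1 (τ (m - e₁₂)) m k,
    fun k m => (-1) ^ (m 1) * dualCoeff τ 2 (τ (m - e₁)) m k]

theorem convol_waveCoeff_dualCoeff (i : Fin 3) (s : ℤˣ) (a : ℤ) (f g : TSeries) (m m' : ZLat) :
    convol (waveCoeff τ i f m) (dualCoeff τ i g m') (s * (a + 1)) =
      algebraMap TSeries TField (diag (residue i s a f g)) /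
        (algebraMap TSeries TField (τ m) * algebraMap TSeries TField (τ m')) := by
  rw [diag_residue, map_convol, div_eq_inv_mul, mul_inv, ← convol_mul_mul]
  simp only [← div_eq_inv_mul]
  rfl

theorem kernel₁_waveData_apply (c : ℤ) (j m : ZLat) :
    (kernel₁ (waveData τ) (dualData τ) c : FOp TField) j m =
      algebraMap TSeries TField (diag (residue 0 1 (c + m 0 - (m + e₁ + j) 0)
        (τ m) (τ (m + e₁ + j)))) /
        (algebraMap TSeries TField (τ m) * algebraMap TSeries TField (τ (m + e₁ + j))) := by
  rw [← convol_waveCoeff_dualCoeff, kernel₁, waveKernel_apply, weight₁_dotProduct]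
  have hj : (m + e₁ + j) 0 = m 0 + 1 + j 0 := rfl
  refine congrArg _ ?_
  rw [hj, Units.val_one]
  ring

theorem add_e₁_add_apply_one (j m : ZLat) : (m + e₁ + j) 1 = m 1 + j 1 :=
  congrArg (· + j 1) (add_zero (m 1))

theorem kernel₂_waveData_apply (c : ℤ) (j m : ZLat) :
    (kernel₂ (waveData τ) (dualData τ) c : FOp TField) j m =
      algebraMap TSeries TField (diag (residue 1 (-1) (-c + m 1 - (m + e₁ + j) 1)
        (τ (m + e₁₂)) (τ (m + e₁ + j - e₁₂)))) /
        (algebraMap TSeries TField (τ m) * algebraMap TSeries TField (τ (m + e₁ + j))) := by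
  rw [← convol_waveCoeff_dualCoeff, kernel₂, waveKernel_apply, weight₂_dotProduct]
  refine congrArg _ ?_
  rw [add_e₁_add_apply_one, Units.val_neg, Units.val_one]
  ring

theorem algebraMap_neg_one_zpow_smul (k : ℤ) (f : TSeries) :
    algebraMap TSeries TField ((-1 : ℂ) ^ k • f) = (-1) ^ k * algebraMap TSeries TField f := by
  rcases Int.even_or_odd k with hk | hk
  · rw [hk.neg_one_zpow, hk.neg_one_zpow, one_smul, one_mul]
  · rw [hk.neg_one_zpow, hk.neg_one_zpow, neg_one_smul, map_neg, neg_one_mul]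

theorem kernel₃_waveData_apply (c : ℤ) (j m : ZLat) :
    (kernel₃ (waveData τ) (dualData τ) c : FOp TField) j m =
      algebraMap TSeries TField ((-1 : ℂ) ^ (m 1 + (m + e₁ + j) 1) •
        diag (residue 2 (-1) (-c + m 0 - m 1 - (m + e₁ + j) 0 + (m + e₁ + j) 1)
          (τ (m + e₁)) (τ (m + e₁ + j - e₁)))) /
        (algebraMap TSeries TField (τ m) * algebraMap TSeries TField (τ (m + e₁ + j))) := by
  rw [algebraMap_neg_one_zpow_smul, mul_div_assoc, ← convol_waveCoeff_dualCoeff,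
    zpow_add₀ (neg_ne_zero.2 one_ne_zero), ← convol_mul_mul, kernel₃, waveKernel_apply,
    weight₃_dotProduct]
  have hj : (m + e₁ + j) 0 = m 0 + 1 + j 0 := rfl
  refine congrArg _ ?_
  rw [add_e₁_add_apply_one, hj, Units.val_neg, Units.val_one]
  ring

variable {τ}

theorem kernel₁_waveData_eq_add (hτ : IsKdVTau n τ) (l : ℕ) :
    (kernel₁ (waveData τ) (dualData τ) (n 0 * l) : FOp TField) =
      kernel₂ (waveData τ) (dualData τ) (n 1 * l) +
        kernel₃ (waveData τ) (dualData τ) (n 2 * l) := by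
  funext j m
  change _ = (kernel₂ (waveData τ) (dualData τ) (n 1 * l) : FOp TField) j m +
    (kernel₃ (waveData τ) (dualData τ) (n 2 * l) : FOp TField) j m
  rw [kernel₁_waveData_apply, kernel₂_waveData_apply, kernel₃_waveData_apply, ← add_div,
    ← map_add, ← map_smul, ← map_add, hτ]

theorem algebraMap_ne_zero (hτ₀ : ∀ m, τ m ≠ 0) (m : ZLat) :
    algebraMap TSeries TField (τ m) ≠ 0 :=
  (map_ne_zero_iff _ (IsFractionRing.injective TSeries TField)).2 (hτ₀ m)

theorem isWaveData (hτ₀ : ∀ m, τ m ≠ 0) (hτ : IsKdVTau n τ) :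
    IsWaveData (waveData τ) (dualData τ) n where
  left_zero_zero m := by
    change waveCoeff τ 0 (τ m) m 0 = 1
    rw [waveCoeff, coeff_zero_miwa, div_self (algebraMap_ne_zero hτ₀ m)]
  right_zero_zero m := by
    change dualCoeff τ 0 (τ m) m 0 = 1
    rw [dualCoeff, coeff_zero_miwa, div_self (algebraMap_ne_zero hτ₀ m)]
  bilinear_zero := by simpa only [Nat.cast_zero, mul_zero] using kernel₁_waveData_eq_add hτ 0
  bilinear_one := by simpa only [Nat.cast_one, mul_one] using kernel₁_waveData_eq_add hτ 1

theorem s₃_zero (m : ZLat) : s₃ τ 0 m =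
    (-1) ^ (m 1) * (algebraMap TSeries TField (τ (m + e₁)) / algebraMap TSeries TField (τ m)) := by
  rw [s₃, waveCoeff, coeff_zero_miwa]

theorem rho_eq_neg_div (hτ₀ : ∀ m, τ m ≠ 0) (m : ZLat) :
    rho τ m = -(waveData τ 2 0 (m + e₁₂) / waveData τ 2 0 m) := by
  change _ = -(s₃ τ 0 (m + e₁₂) / s₃ τ 0 m)
  have hm : (m + e₁₂) 1 = m 1 + 1 := rfl
  have h_sign : (-1 : TField) ^ (m 1) ≠ 0 := zpow_ne_zero _ (neg_ne_zero.2 one_ne_zero)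
  have h₀ := algebraMap_ne_zero hτ₀ m
  have h₁ := algebraMap_ne_zero hτ₀ (m + e₁)
  have h₂ := algebraMap_ne_zero hτ₀ (m + e₁₂)
  rw [s₃_zero, s₃_zero, rho, hm, zpow_add₀ (neg_ne_zero.2 one_ne_zero), zpow_one]
  field_simp

variable (τ)

theorem S₁_eq_seriesOp : S₁ τ = seriesOp 0 1 (waveData τ 0) := by
  funext j m
  simp only [S₁, seriesOp, Units.val_one, one_mul, neg_nonneg, sub_zero]
  rfl

theorem S₂_eq_seriesOp : S₂ τ = seriesOp 1 (-1) (waveData τ 1) := by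
  funext j m
  simp only [S₂, seriesOp, Units.val_neg, Units.val_one, neg_mul, one_mul, neg_neg, sub_self,
    and_comm]
  rfl

theorem S₃_eq_seriesOp : S₃ τ = seriesOp 0 (-1) (waveData τ 2) := by
  funext j m
  simp only [S₃, seriesOp, Units.val_neg, Units.val_one, neg_mul, one_mul, neg_neg, sub_zero]
  rfl

theorem S₃'_eq_seriesOp : S₃' τ = seriesOp 1 1 (waveData τ 2) := by
  funext j m
  simp only [S₃', seriesOp, Units.val_one, one_mul, neg_nonneg, sub_self, and_comm]
  rfl

variable {τ}

theorem L₁_eq_laxSeries (h : IsWaveData (waveData τ) (dualData τ) n) :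
    L₁ τ = laxSeries 0 1 (waveData τ 0) := by
  rw [coe_laxSeries (h.left_ne_zero 0), L₁, S₁_eq_seriesOp, dir, Pi.single_neg, neg_neg]
  rfl

theorem L₂_eq_laxSeries (h : IsWaveData (waveData τ) (dualData τ) n) :
    L₂ τ = laxSeries 1 (-1) (waveData τ 1) := by
  rw [coe_laxSeries (h.left_ne_zero 1), L₂, S₂_eq_seriesOp, dir, Units.val_neg, neg_neg]
  rfl

theorem L₃_eq_laxSeries (h : IsWaveData (waveData τ) (dualData τ) n) :
    L₃ τ = laxSeries 0 (-1) (waveData τ 2) := by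
  rw [coe_laxSeries (h.left_ne_zero 2), L₃, S₃_eq_seriesOp, dir, Units.val_neg, neg_neg]
  rfl

theorem L₃'_eq_laxSeries (h : IsWaveData (waveData τ) (dualData τ) n) :
    L₃' τ = laxSeries 1 1 (waveData τ 2) := by
  rw [coe_laxSeries (h.left_ne_zero 2), L₃', S₃'_eq_seriesOp, dir, Pi.single_neg, neg_neg]
  rfl

theorem laxOp_eq_laxSum (h : IsWaveData (waveData τ) (dualData τ) n) :
    laxOp τ n = laxSum (waveData τ) n := by
  rw [laxOp, B₁, B₂, B₃, L₁_eq_laxSeries h, L₂_eq_laxSeries h, L₃_eq_laxSeries h, laxSum]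

theorem laxOp'_eq_laxSum' (h : IsWaveData (waveData τ) (dualData τ) n) :
    laxOp' τ n = laxSum' (waveData τ) n := by
  rw [laxOp', B₁, B₂, B₃', L₁_eq_laxSeries h, L₂_eq_laxSeries h, L₃'_eq_laxSeries h, laxSum']

end Tau

end ThreeKP

end

theorem mainTheorem12 (n : Fin 3 → ℕ) (τ : ZLat → TSeries) (hτ₀ : ∀ m, τ m ≠ 0)
    (hτ : IsKdVTau n τ) :
    (∀ (α : Fin 2) (ε : ℤˣ), DirectSumDecomposition α ε (H τ)) ∧
    (laxOp τ n ∈ opE TField ∧ laxOp' τ n ∈ opE TField) ∧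
    (proj 0 1 (H τ) (laxOp τ n) = L₁ τ ^ n 0 ∧ proj 0 1 (H τ) (laxOp' τ n) = L₁ τ ^ n 0) ∧
    (proj 0 (-1) (H τ) (laxOp τ n) = L₃ τ ^ n 2 ∧
      proj 0 (-1) (H τ) (laxOp' τ n) = L₃ τ ^ n 2) ∧
    (proj 1 1 (H τ) (laxOp τ n) = L₃' τ ^ n 2 ∧ proj 1 1 (H τ) (laxOp' τ n) = L₃' τ ^ n 2) ∧
    (proj 1 (-1) (H τ) (laxOp τ n) = L₂ τ ^ n 1 ∧
      proj 1 (-1) (H τ) (laxOp' τ n) = L₂ τ ^ n 1) := by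
  have h := isWaveData hτ₀ hτ
  rw [laxOp_eq_laxSum h, laxOp'_eq_laxSum' h, L₁_eq_laxSeries h, L₂_eq_laxSeries h,
    L₃_eq_laxSeries h, L₃'_eq_laxSeries h]
  exact mainTheorem12_general h (rho_eq_neg_div hτ₀)
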